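/- **Definitions.** For a finite abelian group $G$, a set $\Gamma\subseteq G\times G\times G$ is *tricolored sum-free* if any two distinct elements of $\Gamma$ differ in all three coordinates and, for every $\alpha\in\Gamma_1\times\Gamma_2\times\Gamma_3$ (where $\Gamma_i$ is the set of $i$-th coordinates of elements of $\Gamma$), one has $\alpha_1+\alpha_2+\alpha_3=0$ if and only if $\alpha\in\Gamma$. Let $s_3(G)$ be the largest size of a tricolored sum-free set in $G\times G\times G$, and let $\tilde s_3(G)=\lim_{n\to\infty}s_3(G^{n})^{1/n}$. For an integer $m\ge 2$ let $$z(m)=\frac{\gamma^m-1}{\gamma-1}\,\gamma^{-2(m-1)/3},$$ where $\gamma$ is the unique positive real number, $\gamma\neq1$, with $\frac1{\gamma-1}-\frac m{\gamma^m-1}=\frac{m-1}3$. Two tensors $t\in V_1\otimes V_2\otimes V_3$ and $s\in W_1\otimes W_2\otimes W_3$ are *isomorphic* if $(A_1\otimes A_2\otimes A_3)t=s$ for some bijective linear maps $A_i:V_i\to W_i$. The *structure tensor* of a finite-dimensional algebra $A$ with respect to a basis $(a_i)$ is $\sum_{i,j,k}a_k^*(a_ia_j)\,a_i\otimes a_j\otimes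 a_k\in A\otimes A\otimes A$. For $\Phi\subseteq\Psi\subseteq I_1\times I_2\times I_3$, the set $\Phi$ is a *combinatorial degeneration* of $\Psi$ if there are maps $u_i:I_i\to\mathbb Z$ such that $u_1(\alpha_1)+u_2(\alpha_2)+u_3(\alpha_3)$ is $0$ for all $\alpha\in\Phi$ and positive for all $\alpha\in\Psi\setminus\Phi$. **Theorem.** The limit $\tilde s_3(\mathbb Z/3\mathbb Z)$ exists and $$\tilde s_3(\mathbb Z/3\mathbb Z)=\frac{3\,(207+33\sqrt{33})^{1/3}}{8}.$$ More generally, let $m=p^k$ with $p$ prime and $k\ge1$. Then: 1. the number $\gamma$ in the definition of $z(m)$ exists and is unique, the limit $\tilde s_3(\mathbb Z/m\mathbb Z)$ exists, and $\tilde s_3(\mathbb Z/m\mathbb Z)=z(m)$; 2. the cap set tensor $\sum e_{\alpha_1}\otimes e_{\alpha_2}\otimes e_{\alpha_3}$ over $\mathbb F_p$, where the sum is over all $\alpha\in(\mathbb Z/m\mathbb Z)^3$ with $\alpha_1+\alpha_2+\alpha_3=0$ and $(e_x)_{x\in\mathbb Z/m\mathbb Z}$ is the standard basis of $\mathbb F_p^{\,\mathbb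 Z/m\mathbb Z}$, is isomorphic to the structure tensor of the algebra $\mathbb F_p[x]/(x^m)$ with respect to any basis; 3. the set $\{\alpha\in\{0,\dots,m-1\}^3:\alpha_1+\alpha_2+\alpha_3=m-1\}$ is a combinatorial degeneration of $\{\alpha\in\{0,\dots,m-1\}^3:\alpha_1+\alpha_2+\alpha_3\equiv m-1 \pmod m\}$. -/

import Mathlib

open Filter Topology
open scoped TensorProduct Polynomial

/-! ### Tricolored sum-free sets -/

/-- `Γ ⊆ I × J × K` is a diagonal: any two distinct elements differ in all three coordinates. -/
def IsDiagonal {I J K : Type*} (Γ : Set (I × J × K)) : Prop :=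
  ∀ α ∈ Γ, ∀ β ∈ Γ, α ≠ β → α.1 ≠ β.1 ∧ α.2.1 ≠ β.2.1 ∧ α.2.2 ≠ β.2.2

/-- `Γ ⊆ G × G × G` is tricolored sum-free: it is a diagonal, and an element `α` of
`Γ₁ × Γ₂ × Γ₃` (the product of the three marginal sets of `Γ`) satisfies `α₁ + α₂ + α₃ = 0`
if and only if `α ∈ Γ`. -/
def IsTricoloredSumFree {G : Type*} [AddCommGroup G] (Γ : Set (G × G × G)) : Prop :=
  IsDiagonal Γ ∧
    ∀ x ∈ {x : G | ∃ α ∈ Γ, α.1 = x}, ∀ y ∈ {y : G | ∃ α ∈ Γ, α.2.1 = y},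
      ∀ z ∈ {z : G | ∃ α ∈ Γ, α.2.2 = z}, (x + y + z = 0 ↔ (x, y, z) ∈ Γ)

/-- `s₃(G)`, the size of the largest tricolored sum-free set in `G × G × G`, for a finite
abelian group `G`. -/
noncomputable def maxTricolored (G : Type*) [AddCommGroup G] [Finite G] : ℕ :=
  sSup {k : ℕ | ∃ Γ : Set (G × G × G), IsTricoloredSumFree Γ ∧ Γ.ncard = k}

/-- The regularisation `lim_{n → ∞} s₃(Gⁿ)^(1/n)` exists and equals `L`. -/
def HasRegularisedMaxTricolored (G : Type*) [AddCommGroup G] [Finite G] (L : ℝ) : Prop :=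
  Tendsto (fun n : ℕ => (maxTricolored (Fin n → G) : ℝ) ^ ((1 : ℝ) / (n : ℝ))) atTop (𝓝 L)

/-! ### Strassen's value `z(m)` -/

/-- `γ` is a positive real solution of `1 / (γ - 1) - m / (γ ^ m - 1) = (m - 1) / 3`. -/
def IsStrassenRoot (m : ℕ) (γ : ℝ) : Prop :=
  0 < γ ∧ γ ≠ 1 ∧ 1 / (γ - 1) - (m : ℝ) / (γ ^ m - 1) = ((m : ℝ) - 1) / 3

/-- The expression `(γ ^ m - 1) / (γ - 1) * γ ^ (-2 (m - 1) / 3)`, which is `z(m)` when `γ` is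
the unique positive solution of the equation in `IsStrassenRoot`. -/
noncomputable def strassenExpr (m : ℕ) (γ : ℝ) : ℝ :=
  (γ ^ m - 1) / (γ - 1) * γ ^ (-(2 * ((m : ℝ) - 1) / 3))

/-! ### Tensors of order three -/

/-- Two tensors of order three are isomorphic: one is carried to the other by a triple of
bijective linear maps acting on the three tensor factors. -/
def TensorIsomorphic {F : Type*} [Field F] {V₁ V₂ V₃ W₁ W₂ W₃ : Type*}
    [AddCommGroup V₁] [Module F V₁] [AddCommGroup V₂] [Module F V₂]
    [AddCommGroup V₃] [Module F V₃] [AddCommGroup W₁] [Module F W₁]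
    [AddCommGroup W₂] [Module F W₂] [AddCommGroup W₃] [Module F W₃]
    (t : V₁ ⊗[F] (V₂ ⊗[F] V₃)) (s : W₁ ⊗[F] (W₂ ⊗[F] W₃)) : Prop :=
  ∃ (e₁ : V₁ ≃ₗ[F] W₁) (e₂ : V₂ ≃ₗ[F] W₂) (e₃ : V₃ ≃ₗ[F] W₃),
    TensorProduct.congr e₁ (TensorProduct.congr e₂ e₃) t = s

/-- The cap set tensor `∑ e_{α₁} ⊗ e_{α₂} ⊗ e_{α₃}`, the sum being over
`α₁, α₂, α₃ ∈ ℤ/mℤ` with `α₁ + α₂ + α₃ = 0`. -/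
noncomputable def capSetTensor (F : Type*) [Field F] (m : ℕ) [NeZero m] :
    (ZMod m → F) ⊗[F] ((ZMod m → F) ⊗[F] (ZMod m → F)) :=
  ∑ α : ZMod m × ZMod m × ZMod m with α.1 + α.2.1 + α.2.2 = 0,
    Pi.single α.1 (1 : F) ⊗ₜ[F] (Pi.single α.2.1 (1 : F) ⊗ₜ[F] Pi.single α.2.2 (1 : F))

/-- The structure tensor `∑ a₃^*(a₁ a₂) a₁ ⊗ a₂ ⊗ a₃` of an algebra `A`, the sum being over the
elements `a₁, a₂, a₃` of a basis of `A`. -/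
noncomputable def structureTensor {F A ι : Type*} [Field F] [Ring A] [Algebra F A] [Fintype ι]
    (b : Module.Basis ι F A) : A ⊗[F] (A ⊗[F] A) :=
  ∑ i, ∑ j, ∑ k, b.coord k (b i * b j) • (b i ⊗ₜ[F] (b j ⊗ₜ[F] b k))

/-! ### Combinatorial degeneration -/

/-- `Φ ⊆ Ψ` is a combinatorial degeneration of `Ψ`. -/
def IsCombinatorialDegeneration {I J K : Type*} (Ψ Φ : Set (I × J × K)) : Prop :=
  Φ ⊆ Ψ ∧ ∃ (u : I → ℤ) (v : J → ℤ) (w : K → ℤ), ∀ α : I × J × K,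
    (α ∈ Ψ \ Φ → 0 < u α.1 + v α.2.1 + w α.2.2) ∧ (α ∈ Φ → u α.1 + v α.2.1 + w α.2.2 = 0)

/-- The triples in `{0, …, m - 1}³` with sum `m - 1`. -/
def sumSupport (m : ℕ) : Set (Fin m × Fin m × Fin m) :=
  {α | (α.1 : ℕ) + (α.2.1 : ℕ) + (α.2.2 : ℕ) = m - 1}

/-- The triples in `{0, …, m - 1}³` with sum congruent to `m - 1` modulo `m`. -/
def modSumSupport (m : ℕ) : Set (Fin m × Fin m × Fin m) :=
  {α | (α.1 : ℕ) + (α.2.1 : ℕ) + (α.2.2 : ℕ) ≡ m - 1 [MOD m]}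

/-!
The growth rate of tricolored sum-free sets in `(ℤ / m) ^ L`, for `m = p ^ k` and `n = m - 1`, is
squeezed between two expressions in the truncated geometric distribution on `{0, …, n}`,
proportional to `x ^ i`, whose mean is `n / 3`. The ratio is `x = γ⁻¹` for Strassen's root `γ`, and
the entropy of the distribution is `log (∑ i, x ^ i) - n / 3 * log x = log z(m)`.

Upper bound. Modulo `p` the number `choose u (m - 1)` with `u = x + y + z + m - 1` is the indicator
of `x + y + z = 0` in `ℤ / m`, and Vandermonde's identity writes it as the sum over
`a + b + c = m - 1` of products of binomial functions of `x`, `y` and `z` (`sum_binomFun_eq_ite`).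
In the `L`-fold product of this identity each summand has a factor of degree at most `L n / 3`, so
that the slice rank of the indicator tensor is at most three times the number of exponent vectors
of that degree (`maxTricolored_le_three_mul_card_lowDegree`), which is at most `z(m) ^ L`
(`card_lowDegree_le`). On the other hand a tricolored sum-free set restricts the tensor to a
diagonal, whose slice rank is its size (`card_le_of_slice_decomposition`). The binomial functions
form bases, so the same identity is the isomorphism of the cap set tensor with the structure
tensor of `F_p[x] / (x ^ m)` (`tensorIsomorphic_capSetTensor`).

Lower bound. The geometric distribution above is the marginal of a cyclically symmetric measure on
the triples with sum `n` (`exists_cyclic_weight`). This rests on a study of the cone of all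
marginals: up to constants it contains every function `i ↦ max (k - i) 0` (`tentFun_mem`), hence
every decreasing convex function, and the constant is determined by the mean. Rounding the measure
gives words `x`, `y`, `z` of equal letter frequencies and pointwise sum `n`. Among the
rearrangements of `x`, sums congruent to `n` modulo `m` at every position are equal to `n`, since
the total is fixed, so the combinatorial degeneration of the sums modulo `m` to the sums in `ℕ`
costs nothing. An affine hash function with values restricted to a progression-free set of
Behrend's density extracts, from all triples of rearrangements with sum `n`, an induced diagonal
almost as large as the number of rearrangements (`exists_induced_diagonal`,
`exists_large_induced_diagonal`), which is the exponential of the entropy up to lower order terms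
(`exists_lower_rate`).
-/

/-! ### The cone of marginals of triples with a fixed sum -/

/-- The triples of natural numbers with sum `n`. -/
def triplesOfSum (n : ℕ) : Finset (ℕ × ℕ × ℕ) :=
  (Finset.range (n + 1) ×ˢ Finset.range (n + 1) ×ˢ Finset.range (n + 1)).filter
    fun t => t.1 + t.2.1 + t.2.2 = n

lemma mem_triplesOfSum {n : ℕ} {t : ℕ × ℕ × ℕ} :
    t ∈ triplesOfSum n ↔ t.1 + t.2.1 + t.2.2 = n := by
  simp only [triplesOfSum, Finset.mem_filter, Finset.mem_product, Finset.mem_range]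
  omega

/-- The function counting how often each number occurs as an entry of the triple `(a, b, c)`. -/
def entryCount (a b c : ℕ) : ℕ → ℝ := Pi.single a 1 + Pi.single b 1 + Pi.single c 1

/-- The functions `i ↦ ∑ w(t) · #{entries of t equal to i}` for a nonnegative weight `w` on the
triples `t` with sum `n`. -/
def marginalCone (n : ℕ) : AddSubmonoid (ℕ → ℝ) where
  carrier := {f | ∃ w : ℕ × ℕ × ℕ → ℝ, (∀ t, 0 ≤ w t) ∧
    f = ∑ t ∈ triplesOfSum n, w t • entryCount t.1 t.2.1 t.2.2}
  zero_mem' := ⟨0, fun _ => le_rfl, by simp⟩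
  add_mem' := by
    rintro _ _ ⟨v, hv, rfl⟩ ⟨w, hw, rfl⟩
    exact ⟨v + w, fun t => add_nonneg (hv t) (hw t), by
      simp [add_smul, Finset.sum_add_distrib]⟩

lemma smul_mem_marginalCone {n : ℕ} {f : ℕ → ℝ} {c : ℝ} (hc : 0 ≤ c) (hf : f ∈ marginalCone n) :
    c • f ∈ marginalCone n := by
  obtain ⟨w, hw, rfl⟩ := hf
  exact ⟨c • w, fun t => mul_nonneg hc (hw t), by simp [Finset.smul_sum, mul_smul]⟩

lemma entryCount_mem_marginalCone {n a b c : ℕ} (h : a + b + c = n) :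
    entryCount a b c ∈ marginalCone n := by
  classical
  refine ⟨Pi.single (a, b, c) 1, fun t => ?_, ?_⟩
  · by_cases ht : t = (a, b, c)
    · simp [ht]
    · simp [Pi.single_eq_of_ne ht]
  · rw [Finset.sum_eq_single (a, b, c)]
    · simp
    · intro t _ ht
      simp [Pi.single_eq_of_ne ht]
    · intro ht
      exact absurd (mem_triplesOfSum.2 h) ht

/-- The indicator function of `{0, …, r - 1}`. -/
def stepFun (r : ℕ) : ℕ → ℝ := fun i => if i < r then 1 else 0

/-- The function `i ↦ max (k - i) 0`. -/
def tentFun (k : ℕ) : ℕ → ℝ := fun i => if i < k then (k : ℝ) - i else 0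

@[simp] lemma stepFun_zero : stepFun 0 = 0 := by ext; simp [stepFun]

@[simp] lemma tentFun_zero : tentFun 0 = 0 := by ext; simp [tentFun]

lemma single_eq_stepFun_sub (a : ℕ) : (Pi.single a 1 : ℕ → ℝ) = stepFun (a + 1) - stepFun a := by
  ext i
  rcases lt_trichotomy i a with h | rfl | h
  · simp [stepFun, h, h.ne, Nat.lt_succ_of_lt h]
  · simp [stepFun]
  · simp [stepFun, h.ne', not_lt.2 h.le, not_lt.2 (Nat.succ_le_of_lt h)]

lemma tentFun_succ (k : ℕ) : tentFun (k + 1) = tentFun k + stepFun (k + 1) := by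
  ext i
  simp only [tentFun, stepFun, Pi.add_apply]
  rcases lt_trichotomy i k with h | rfl | h
  · rw [if_pos (by omega), if_pos h, if_pos (by omega)]; push_cast; ring
  · simp
  · rw [if_neg (by omega), if_neg (by omega), if_neg (by omega)]; simp

/-- The functions that lie in `marginalCone n` up to a multiple of the indicator function of
`{0, …, n}`. -/
def marginalConeModFlat (n : ℕ) : AddSubmonoid (ℕ → ℝ) where
  carrier := {f | ∃ c : ℝ, f + c • stepFun (n + 1) ∈ marginalCone n}
  zero_mem' := ⟨0, by simp [zero_mem]⟩
  add_mem' := by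
    rintro f g ⟨c, hc⟩ ⟨d, hd⟩
    refine ⟨c + d, ?_⟩
    convert add_mem hc hd using 1
    module

lemma smul_mem_marginalConeModFlat {n : ℕ} {f : ℕ → ℝ} {c : ℝ} (hc : 0 ≤ c)
    (hf : f ∈ marginalConeModFlat n) : c • f ∈ marginalConeModFlat n := by
  obtain ⟨d, hd⟩ := hf
  refine ⟨c * d, ?_⟩
  convert smul_mem_marginalCone hc hd using 1
  module

lemma mem_marginalConeModFlat_of_eq {n : ℕ} {f g : ℕ → ℝ} (hg : g ∈ marginalCone n) (c : ℝ)
    (h : g = f + c • stepFun (n + 1)) : f ∈ marginalConeModFlat n := ⟨c, h ▸ hg⟩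

lemma mem_of_smul_mem_marginalConeModFlat {n : ℕ} {f g : ℕ → ℝ} {c : ℝ} (hc : 0 < c)
    (hg : g ∈ marginalConeModFlat n) (h : g = c • f) : f ∈ marginalConeModFlat n := by
  have := smul_mem_marginalConeModFlat (inv_nonneg.2 hc.le) hg
  rwa [h, smul_smul, inv_mul_cancel₀ hc.ne', one_smul] at this

/-! ### Two families of triples -/

lemma sum_range_single (b N : ℕ) :
    ∑ y ∈ Finset.range N, (Pi.single (b + y) 1 : ℕ → ℝ) = stepFun (b + N) - stepFun b := by
  induction N with
  | zero => simp
  | succ N ih =>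
    rw [Finset.sum_range_succ, ih, single_eq_stepFun_sub, ← add_assoc]
    abel

/-- The triples `(a, y, n - a - y)` with `b ≤ y ≤ n - a - b`, where `N` is the number of
them. -/
lemma row_mem_marginalCone {n a b N : ℕ} (h : a + 2 * b + N = n + 1) :
    (N : ℝ) • (stepFun (a + 1) - stepFun a) + (2 : ℝ) • (stepFun (b + N) - stepFun b)
      ∈ marginalCone n := by
  have hs : ∑ y ∈ Finset.range N, entryCount a (b + y) (b + (N - 1 - y)) ∈ marginalCone n :=
    sum_mem fun y hy => entryCount_mem_marginalCone (by
      have := Finset.mem_range.1 hy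
      omega)
  convert hs using 1
  simp only [entryCount, Finset.sum_add_distrib, sum_range_single]
  rw [Finset.sum_range_reflect (fun y => (Pi.single (b + y) 1 : ℕ → ℝ)) N, sum_range_single,
    Finset.sum_const, Finset.card_range, single_eq_stepFun_sub]
  rw [← Nat.cast_smul_eq_nsmul ℝ]
  module

/-- The marginal of the first `u` points of the staircase
`(0, 0, n), (1, 0, n - 1), (1, 1, n - 2), (2, 1, n - 3), …`. -/
def staircase (n u : ℕ) : ℕ → ℝ :=
  ∑ s ∈ Finset.range u, entryCount ((s + 1) / 2) (s / 2) (n - s)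

lemma staircase_mem_marginalCone {n u : ℕ} (h : u ≤ n + 1) : staircase n u ∈ marginalCone n :=
  sum_mem fun s hs => entryCount_mem_marginalCone (by
    have := Finset.mem_range.1 hs
    omega)

lemma staircase_two_mul {n r : ℕ} (h : 2 * r ≤ n + 1) :
    staircase n (2 * r) = (3 : ℝ) • stepFun r + stepFun (r + 1) - stepFun 1
      + (stepFun (n + 1) - stepFun (n + 1 - 2 * r)) := by
  induction r with
  | zero => simp [staircase]
  | succ r ih =>
    have e : 2 * (r + 1) = 2 * r + 1 + 1 := by ring
    have e1 : (2 * r + 1) / 2 = r := by omega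
    have e2 : (2 * r + 1 + 1) / 2 = r + 1 := by omega
    have e3 : 2 * r / 2 = r := by omega
    have e4 : n + 1 - 2 * r = n - 2 * r + 1 := by omega
    have e5 : n - 2 * r = n - (2 * r + 1) + 1 := by omega
    have e6 : n + 1 - (2 * r + 1 + 1) = n - (2 * r + 1) := by omega
    rw [e, staircase, Finset.sum_range_succ, Finset.sum_range_succ, ← staircase, ih (by omega)]
    simp only [entryCount, e1, e2, e3, single_eq_stepFun_sub]
    rw [e4, e6, ← e5]
    module

lemma staircase_two_mul_add_one {n r : ℕ} (h : 2 * r ≤ n) :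
    staircase n (2 * r + 1) = stepFun r + (3 : ℝ) • stepFun (r + 1) - stepFun 1
      + (stepFun (n + 1) - stepFun (n - 2 * r)) := by
  have e1 : (2 * r + 1) / 2 = r := by omega
  have e3 : 2 * r / 2 = r := by omega
  have e4 : n + 1 - 2 * r = n - 2 * r + 1 := by omega
  rw [staircase, Finset.sum_range_succ, ← staircase, staircase_two_mul (by omega)]
  simp only [entryCount, e1, e3, single_eq_stepFun_sub]
  rw [e4]
  module

/-! ### Steps and tents in the cone -/

lemma stepFun_one_mem (n : ℕ) : stepFun 1 ∈ marginalConeModFlat n := by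
  have h := row_mem_marginalCone (n := n) (a := 0) (b := 0) (N := n + 1) (by ring)
  refine mem_of_smul_mem_marginalConeModFlat (c := n + 1) (by positivity)
    (mem_marginalConeModFlat_of_eq h 2 ?_) rfl
  simp

/-- The triples with smallest entry `r` in the first position, completed by the staircase so that
the large numbers are hit equally often. -/
lemma completedRow_mem {n r : ℕ} (h : 3 * r ≤ n) :
    ((n : ℝ) - 3 * r + 3) • (stepFun (r + 1) - stepFun r) + (6 : ℝ) • stepFun r
      - (2 : ℝ) • stepFun 1 ∈ marginalConeModFlat n := by
  have h1 := row_mem_marginalCone (n := n) (a := r) (b := r) (N := n - 3 * r + 1) (by omega)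
  have h2 := smul_mem_marginalCone (c := 2) (by norm_num)
    (staircase_mem_marginalCone (n := n) (u := 2 * r) (by omega))
  refine mem_marginalConeModFlat_of_eq (add_mem h1 h2) 2 ?_
  rw [staircase_two_mul (by omega), show r + (n - 3 * r + 1) = n + 1 - 2 * r by omega]
  push_cast [Nat.cast_sub h]
  module

lemma stepFun_mem {n r : ℕ} (h : 3 * r ≤ n) : stepFun r ∈ marginalConeModFlat n := by
  induction r with
  | zero => simp
  | succ r ih =>
    have h3 : (3 : ℝ) * (r + 1) ≤ n := by exact_mod_cast h
    refine mem_of_smul_mem_marginalConeModFlat (c := (n : ℝ) - 3 * r + 3) (by linarith)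
      (add_mem (add_mem (completedRow_mem (r := r) (by omega))
        (smul_mem_marginalConeModFlat (c := (n : ℝ) - 3 * r - 3) (by linarith) (ih (by omega))))
        (smul_mem_marginalConeModFlat (c := 2) (by norm_num) (stepFun_one_mem n))) ?_
    module

lemma tentFun_sub_mem {n i k : ℕ} (hik : i ≤ k) (h : 3 * k ≤ n) :
    tentFun k - tentFun i ∈ marginalConeModFlat n := by
  induction k, hik using Nat.le_induction with
  | base => simp
  | succ k hk ih =>
    rw [tentFun_succ, add_sub_right_comm]
    exact add_mem (ih (by omega)) (stepFun_mem h)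

lemma tentFun_mem_of_le {n k : ℕ} (h : 3 * k ≤ n + 3) : tentFun k ∈ marginalConeModFlat n := by
  have low : ∀ {k}, 3 * k ≤ n → tentFun k ∈ marginalConeModFlat n := fun {k} hk => by
    simpa using tentFun_sub_mem (Nat.zero_le k) hk
  by_cases hk : 3 * k ≤ n
  · exact low hk
  obtain ⟨r, rfl⟩ : ∃ r, k = r + 1 := ⟨k - 1, by omega⟩
  rcases r with _ | r
  · rw [tentFun_succ]; simpa using stepFun_one_mem n
  have hr : 3 * ((r : ℝ) + 1) ≤ n := by exact_mod_cast (by omega : 3 * (r + 1) ≤ n)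
  -- `N` is at most `5` here, so that the row leaves the multiple `6 - N > 0` of
  -- `stepFun (r + 1)`; the step of length `r + 1` in the tent absorbs it, as `6 - N ≤ N`.
  set N : ℝ := (n : ℝ) - 3 * (r + 1) + 3 with hN
  refine mem_of_smul_mem_marginalConeModFlat (c := N) (by linarith)
    (add_mem (add_mem (add_mem (completedRow_mem (r := r + 1) (by omega))
      (smul_mem_marginalConeModFlat (c := 2 * N - 6) (by linarith)
        (stepFun_mem (r := r + 1) (by omega))))
      (smul_mem_marginalConeModFlat (c := N) (by linarith) (low (k := r) (by omega))))
      (smul_mem_marginalConeModFlat (c := 2) (by norm_num) (stepFun_one_mem n))) ?_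
  rw [tentFun_succ, tentFun_succ]
  push_cast
  rw [← hN]
  module

lemma sum_range_stepFun_reflect {n u : ℕ} (h : u ≤ n) :
    ∑ v ∈ Finset.range u, stepFun (n - v) = tentFun n - tentFun (n - u) := by
  induction u with
  | zero => simp
  | succ u ih =>
    rw [Finset.sum_range_succ, ih (by omega), show n - u = n - (u + 1) + 1 by omega,
      tentFun_succ]
    abel

lemma tentFun_self_mem (n : ℕ) : tentFun n ∈ marginalConeModFlat n := by
  have h : ∑ a ∈ Finset.range (n + 1), (((n + 1 - a : ℕ) : ℝ) • (stepFun (a + 1) - stepFun a) +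
      (2 : ℝ) • (stepFun (0 + (n + 1 - a)) - stepFun 0)) ∈ marginalCone n :=
    sum_mem fun a ha => row_mem_marginalCone (by
      have := Finset.mem_range.1 ha
      omega)
  have key : ∀ r ≤ n + 1, ∑ a ∈ Finset.range r,
      ((n + 1 - a : ℕ) : ℝ) • (stepFun (a + 1) - stepFun a)
        = ((n : ℝ) + 1 - r) • stepFun r + tentFun r := by
    intro r hr
    induction r with
    | zero => simp
    | succ r ih =>
      rw [Finset.sum_range_succ, ih (by omega), tentFun_succ, Nat.cast_sub (by omega)]
      push_cast
      module
  refine mem_of_smul_mem_marginalConeModFlat (c := 3) (by norm_num)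
    (mem_marginalConeModFlat_of_eq h 3 ?_) rfl
  rw [Finset.sum_add_distrib, key _ le_rfl]
  simp only [zero_add, stepFun_zero, sub_zero]
  rw [← Finset.smul_sum, sum_range_stepFun_reflect le_rfl, Nat.sub_self, tentFun_zero,
    tentFun_succ]
  push_cast
  module

/-! ### Tents of arbitrary length -/

/-- The triples with all entries smaller than `k` show that a positive multiple of `tentFun k`
is the sum of an element of the cone and of multiples of shorter tents. -/
lemma boundedTriples_mem {n k : ℕ} (hk : k ≤ n) (h : n + 2 ≤ 2 * k) :
    (((n - k : ℕ) : ℝ) + 2) • tentFun k - (((n - k : ℕ) : ℝ) + 1) • tentFun (k - 1)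
      - (2 : ℝ) • tentFun (n - k + 1) ∈ marginalConeModFlat n := by
  obtain ⟨q, rfl⟩ : ∃ q, n = k + q := ⟨n - k, by omega⟩
  obtain ⟨l, rfl⟩ : ∃ l, k = l + 1 := ⟨k - 1, by omega⟩
  rw [show l + 1 + q - (l + 1) = q by omega, show l + 1 - 1 = l by omega]
  have h1 : ∑ a ∈ Finset.range (q + 1), (((l - q + a : ℕ) : ℝ) • (stepFun (a + 1) - stepFun a) +
      (2 : ℝ) • (stepFun (q + 1 - a + (l - q + a)) - stepFun (q + 1 - a)))
        ∈ marginalCone (l + 1 + q) :=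
    sum_mem fun a ha => row_mem_marginalCone (by
      have := Finset.mem_range.1 ha
      omega)
  have h2 : ∑ a ∈ Finset.Ico (q + 1) (l + 1), (((l + 1 + q + 1 - a : ℕ) : ℝ) •
      (stepFun (a + 1) - stepFun a) + (2 : ℝ) • (stepFun (0 + (l + 1 + q + 1 - a)) - stepFun 0))
        ∈ marginalCone (l + 1 + q) :=
    sum_mem fun a ha => row_mem_marginalCone (by
      have := Finset.mem_Ico.1 ha
      omega)
  have key1 : ∀ r, ∑ a ∈ Finset.range r, ((l - q + a : ℕ) : ℝ) • (stepFun (a + 1) - stepFun a)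
        = ((l : ℝ) - q + r) • stepFun r - tentFun r := by
    intro r
    induction r with
    | zero => simp
    | succ r ih =>
      rw [Finset.sum_range_succ, ih, tentFun_succ]
      push_cast [Nat.cast_sub (show q ≤ l by omega)]
      module
  have key2 : ∀ r, q + 1 ≤ r → r ≤ l + 1 → ∑ a ∈ Finset.Ico (q + 1) r,
      ((l + 1 + q + 1 - a : ℕ) : ℝ) • (stepFun (a + 1) - stepFun a)
        = ((l : ℝ) + q + 2 - r) • stepFun r + tentFun r
          - (((l : ℝ) + 1) • stepFun (q + 1) + tentFun (q + 1)) := by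
    intro r hr
    induction r, hr using Nat.le_induction with
    | base => intro _; simp; module
    | succ r hr ih =>
      intro hr'
      rw [Finset.sum_Ico_succ_top hr, ih (by omega), tentFun_succ r, Nat.cast_sub (by omega)]
      push_cast
      module
  have key3 : ∀ r, q + 1 ≤ r → r ≤ l + 1 → ∑ a ∈ Finset.Ico (q + 1) r,
      stepFun (l + 1 + q + 1 - a) = tentFun (l + 1) - tentFun (l + 1 + q + 1 - r) := by
    intro r hr
    induction r, hr using Nat.le_induction with
    | base => intro _; simp [show l + 1 + q + 1 - (q + 1) = l + 1 by omega]
    | succ r hr ih =>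
      intro hr'
      rw [Finset.sum_Ico_succ_top hr, ih (by omega),
        show l + 1 + q + 1 - r = l + 1 + q + 1 - (r + 1) + 1 by omega, tentFun_succ (_ - _)]
      abel
  have h3 : ∑ a ∈ Finset.range (q + 1),
      (stepFun (q + 1 - a + (l - q + a)) - stepFun (q + 1 - a))
        = ((q : ℝ) + 1) • stepFun (l + 1) - tentFun (q + 1) := by
    rw [Finset.sum_sub_distrib, sum_range_stepFun_reflect le_rfl, Nat.sub_self, tentFun_zero,
      sub_zero, Finset.sum_congr rfl fun a ha => by
        rw [show q + 1 - a + (l - q + a) = l + 1 by have := Finset.mem_range.1 ha; omega]]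
    rw [Finset.sum_const, Finset.card_range, ← Nat.cast_smul_eq_nsmul ℝ]
    push_cast
    rfl
  refine mem_of_smul_mem_marginalConeModFlat (c := 3) (by norm_num)
    (mem_marginalConeModFlat_of_eq (add_mem h1 h2) 0 ?_) rfl
  rw [Finset.sum_add_distrib, Finset.sum_add_distrib, key1, key2 _ (by omega) le_rfl,
    ← Finset.smul_sum, ← Finset.smul_sum, h3]
  simp only [zero_add, stepFun_zero, sub_zero]
  rw [key3 _ (by omega) le_rfl, show l + 1 + q + 1 - (l + 1) = q + 1 by omega, tentFun_succ l]
  push_cast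
  module

lemma sum_staircase_even {n r : ℕ} (h : 2 * (r + 1) ≤ n) :
    ∑ v ∈ Finset.range (2 * (r + 1)), staircase n (v + 1)
      = tentFun (r + 2) + (6 : ℝ) • tentFun (r + 1) + tentFun r - (2 * (r : ℝ) + 3) • stepFun 1
        + (2 * (r : ℝ) + 2) • stepFun (n + 1) - (tentFun n - tentFun (n - 2 * (r + 1))) := by
  induction r with
  | zero =>
    have e1 := staircase_two_mul_add_one (n := n) (r := 0) (by omega)
    have e2 := staircase_two_mul (n := n) (r := 1) (by omega)
    have e3 := sum_range_stepFun_reflect (n := n) (u := 2) (by omega)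
    simp only [Finset.sum_range_succ, Finset.sum_range_zero, Nat.mul_one, Nat.mul_zero,
      Nat.sub_zero, zero_add, stepFun_zero, Nat.reduceAdd] at e1 e2 e3 ⊢
    rw [← e3, e1, e2, show n + 1 - 2 = n - 1 by omega, tentFun_succ 1, tentFun_succ 0,
      tentFun_zero]
    push_cast
    module
  | succ r ih =>
    rw [show 2 * (r + 1 + 1) = 2 * (r + 1) + 1 + 1 by ring, Finset.sum_range_succ,
      Finset.sum_range_succ, ih (by omega), staircase_two_mul_add_one (by omega),
      show 2 * (r + 1) + 1 + 1 = 2 * (r + 2) by ring, staircase_two_mul (by omega),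
      tentFun_succ (r + 2), tentFun_succ (r + 1), tentFun_succ r,
      show n - 2 * (r + 1) = n - 2 * (r + 2) + 1 + 1 by omega, tentFun_succ, tentFun_succ,
      show n + 1 - 2 * (r + 2) = n - 2 * (r + 2) + 1 by omega]
    push_cast
    module

lemma sum_staircase_odd {n r : ℕ} (h : 2 * r + 1 ≤ n) :
    ∑ v ∈ Finset.range (2 * r + 1), staircase n (v + 1)
      = (4 : ℝ) • tentFun (r + 1) + (4 : ℝ) • tentFun r - (2 * (r : ℝ) + 2) • stepFun 1
        + (2 * (r : ℝ) + 1) • stepFun (n + 1) - (tentFun n - tentFun (n - (2 * r + 1))) := by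
  rcases r with _ | r
  · have e1 := staircase_two_mul_add_one (n := n) (r := 0) (by omega)
    have e3 := sum_range_stepFun_reflect (n := n) (u := 1) (by omega)
    simp only [Finset.sum_range_succ, Finset.sum_range_zero, Nat.mul_zero,
      Nat.sub_zero, zero_add, stepFun_zero] at e1 e3 ⊢
    rw [← e3, e1, tentFun_succ 0, tentFun_zero]
    push_cast
    module
  · rw [Finset.sum_range_succ, sum_staircase_even (by omega), staircase_two_mul_add_one (by omega),
      tentFun_succ (r + 1), tentFun_succ r, show n - 2 * (r + 1) = n - (2 * (r + 1) + 1) + 1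
      by omega, tentFun_succ]
    push_cast
    module

/-- A decreasing weight on the staircase, linear except for one concave kink and a final jump. -/
lemma weightedStaircase_mem {n k K : ℕ} (hK : K + 2 ≤ k) (hk : 2 * k ≤ n + 1) :
    (10 : ℝ) • tentFun k - (2 : ℝ) • tentFun (k - 2) - (2 * (k : ℝ) + 2) • stepFun 1
      + (3 : ℝ) • tentFun (n + 1 - 2 * k) - (2 : ℝ) • tentFun (n + 2 - 2 * k) - tentFun n
      - (3 / 4 : ℝ) • ((4 : ℝ) • tentFun (K + 1) + (4 : ℝ) • tentFun K
        - (2 * (K : ℝ) + 2) • stepFun 1 - tentFun n + tentFun (n - (2 * K + 1)))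
      ∈ marginalConeModFlat n := by
  obtain ⟨r, rfl⟩ : ∃ r, k = r + 2 := ⟨k - 2, by omega⟩
  have hmem : ∀ a b : ℕ, b ≤ n + 1 →
      ∑ v ∈ Finset.Ico a b, staircase n (v + 1) ∈ marginalCone n := fun a b hb =>
    sum_mem fun v hv => staircase_mem_marginalCone (by
      have := Finset.mem_Ico.1 hv
      omega)
  have h1 := hmem (2 * K + 1) (2 * (r + 1)) (by omega)
  have h2 := smul_mem_marginalCone (c := 1 / 4) (by norm_num) (hmem 0 (2 * K + 1) (by omega))
  have h3 := smul_mem_marginalCone (c := 3) (by norm_num)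
    (staircase_mem_marginalCone (n := n) (u := 2 * (r + 1) + 1) (by omega))
  rw [Finset.sum_Ico_eq_sub _ (show 2 * K + 1 ≤ 2 * (r + 1) by omega)] at h1
  rw [Nat.Ico_zero_eq_range] at h2
  refine mem_marginalConeModFlat_of_eq (add_mem (add_mem h1 h2) h3)
    (2 * r + 5 - 3 / 4 * (2 * K + 1)) ?_
  rw [sum_staircase_odd (by omega), sum_staircase_even (by omega),
    staircase_two_mul_add_one (by omega), show n + 2 - 2 * (r + 2) = n - 2 * (r + 1) by omega,
    show n - 2 * (r + 1) = n + 1 - 2 * (r + 2) + 1 by omega, tentFun_succ (n + 1 - _),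
    tentFun_succ (r + 1), tentFun_succ r, show r + 2 - 2 = r by omega]
  push_cast
  module

/-- Every tent function is, up to a constant on `{0, …, n}`, the marginal of a measure on the
triples with sum `n`. -/
theorem tentFun_mem {n k : ℕ} (hk : k ≤ n) : tentFun k ∈ marginalConeModFlat n := by
  induction k using Nat.strong_induction_on with
  | _ k ih =>
  by_cases h1 : 3 * k ≤ n + 3
  · exact tentFun_mem_of_le h1
  by_cases h2 : 2 * k ≤ n + 1
  · -- The staircase expresses `10 • tentFun k` by shorter tents; the subtracted tents are
    -- compensated by tents of length at most about `n / 3` and by the tent of length `n`.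
    obtain ⟨K, hK⟩ : ∃ K, K = n / 3 := ⟨_, rfl⟩
    have hKk : (K : ℝ) + 2 ≤ k := by exact_mod_cast (by omega : K + 2 ≤ k)
    refine mem_of_smul_mem_marginalConeModFlat (c := 10) (by norm_num)
      (add_mem (add_mem (add_mem (add_mem (add_mem (add_mem (add_mem
      (weightedStaircase_mem (n := n) (k := k) (K := K) (by omega) h2)
      (smul_mem_marginalConeModFlat (c := 2) (by norm_num) (ih (k - 2) (by omega) (by omega))))
      (smul_mem_marginalConeModFlat (c := 3) (by norm_num)
        (tentFun_sub_mem (n := n) (i := n + 1 - 2 * k) (k := K) (by omega) (by omega))))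
      (smul_mem_marginalConeModFlat (c := 3) (by norm_num)
        (tentFun_mem_of_le (n := n) (k := K + 1) (by omega))))
      (smul_mem_marginalConeModFlat (c := 2) (by norm_num)
        (tentFun_mem_of_le (n := n) (k := n + 2 - 2 * k) (by omega))))
      (smul_mem_marginalConeModFlat (c := 3 / 4) (by norm_num)
        (tentFun_mem_of_le (n := n) (k := n - (2 * K + 1)) (by omega))))
      (smul_mem_marginalConeModFlat (c := 1 / 4) (by norm_num) (tentFun_self_mem n)))
      (smul_mem_marginalConeModFlat (c := 2 * (k : ℝ) + 2 - 3 / 4 * (2 * K + 2)) (by linarith)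
        (stepFun_one_mem n))) ?_
    module
  · -- For long tents the triples with entries below `k` suffice.
    refine mem_of_smul_mem_marginalConeModFlat (c := ((n - k : ℕ) : ℝ) + 2) (by positivity)
      (add_mem (add_mem (boundedTriples_mem hk (by omega))
      (smul_mem_marginalConeModFlat (c := ((n - k : ℕ) : ℝ) + 1) (by positivity)
        (ih (k - 1) (by omega) (by omega))))
      (smul_mem_marginalConeModFlat (c := 2) (by norm_num)
        (ih (n - k + 1) (by omega) (by omega)))) ?_
    module

/-! ### Geometric distributions -/

/-- The function `i ↦ x ^ i` on `{0, …, n}`, extended by `0`. -/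
def geomFun (n : ℕ) (x : ℝ) : ℕ → ℝ := fun i => if i < n + 1 then x ^ i else 0

lemma geomFun_mem_modFlat {n : ℕ} (hn : 0 < n) {x : ℝ} (hx0 : 0 ≤ x) (hx1 : x ≤ 1) :
    geomFun n x ∈ marginalConeModFlat n := by
  -- A convex sequence is a nonnegative combination of tents.
  have key : ∀ j ≤ n, (fun i : ℕ => if i < j then x ^ i - x ^ j
      - ((j : ℝ) - i) * (x ^ j - x ^ (j + 1)) else 0) ∈ marginalConeModFlat n := by
    intro j hj
    induction j with
    | zero =>
      simp only [Nat.not_lt_zero, if_false]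
      exact zero_mem (marginalConeModFlat n)
    | succ j ih =>
      have hc : 0 ≤ x ^ j - 2 * x ^ (j + 1) + x ^ (j + 2) := by
        have : x ^ j - 2 * x ^ (j + 1) + x ^ (j + 2) = x ^ j * (1 - x) ^ 2 := by ring
        rw [this]; positivity
      convert add_mem (ih (by omega))
        (smul_mem_marginalConeModFlat hc (tentFun_mem hj)) using 1
      ext i
      simp only [tentFun, Pi.add_apply, Pi.smul_apply, smul_eq_mul]
      rcases lt_trichotomy i j with h | rfl | h
      · rw [if_pos (by omega), if_pos h, if_pos (by omega)]; push_cast; ring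
      · simp; ring
      · rw [if_neg (by omega), if_neg (by omega), if_neg (by omega)]; simp
  obtain ⟨l, rfl⟩ : ∃ l, n = l + 1 := ⟨n - 1, by omega⟩
  have hc : 0 ≤ x ^ l - x ^ (l + 1) := by
    have : x ^ l - x ^ (l + 1) = x ^ l * (1 - x) := by ring
    rw [this]
    exact mul_nonneg (pow_nonneg hx0 _) (by linarith)
  obtain ⟨c, hcmem⟩ := add_mem (key l (by omega))
    (smul_mem_marginalConeModFlat hc (tentFun_mem le_rfl))
  refine ⟨c - x ^ (l + 1), ?_⟩
  convert hcmem using 1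
  ext i
  simp only [geomFun, stepFun, tentFun, Pi.add_apply, Pi.smul_apply, smul_eq_mul]
  rcases lt_trichotomy i l with h | rfl | h
  · rw [if_pos (by omega), if_pos (by omega), if_pos h, if_pos (by omega)]; push_cast; ring
  · simp; ring
  · by_cases h' : i = l + 1
    · subst h'; simp
    · rw [if_neg (by omega), if_neg (by omega), if_neg (by omega), if_neg (by omega)]; simp

lemma sum_mul_entryCount {n a b c : ℕ} (h : a + b + c = n) (g : ℕ → ℝ) :
    ∑ i ∈ Finset.range (n + 1), g i * entryCount a b c i = g a + g b + g c := by
  have : ∀ d ≤ n, ∑ i ∈ Finset.range (n + 1), g i * (Pi.single d 1 : ℕ → ℝ) i = g d := by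
    intro d hd
    rw [Finset.sum_eq_single d]
    · simp
    · intro i _ hi; simp [Pi.single_eq_of_ne hi]
    · intro hd'; exact absurd (Finset.mem_range.2 (by omega)) hd'
  simp only [entryCount, Pi.add_apply, mul_add, Finset.sum_add_distrib]
  rw [this a (by omega), this b (by omega), this c (by omega)]

lemma sum_weight_eq_zero_of_mem {n : ℕ} {f : ℕ → ℝ} (hf : f ∈ marginalCone n) :
    ∑ i ∈ Finset.range (n + 1), (3 * (i : ℝ) - n) * f i = 0 := by
  obtain ⟨w, -, rfl⟩ := hf
  simp only [Finset.sum_apply, Pi.smul_apply, smul_eq_mul, Finset.mul_sum]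
  rw [Finset.sum_comm]
  refine Finset.sum_eq_zero fun t ht => ?_
  have ht' := mem_triplesOfSum.1 ht
  have := sum_mul_entryCount ht' (fun i => 3 * (i : ℝ) - n)
  calc _ = w t * ∑ i ∈ Finset.range (n + 1), (3 * (i : ℝ) - n) * entryCount t.1 t.2.1 t.2.2 i := by
        rw [Finset.mul_sum]; exact Finset.sum_congr rfl fun i _ => by ring
    _ = 0 := by
        rw [this, ← ht']
        push_cast
        ring

lemma sum_range_weight (n : ℕ) :
    ∑ i ∈ Finset.range (n + 1), (3 * (i : ℝ) - n) = n * (n + 1) / 2 := by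
  have h : ∑ i ∈ Finset.range (n + 1), (i : ℝ) = n * (n + 1) / 2 := by
    induction n with
    | zero => simp
    | succ n ih => rw [Finset.sum_range_succ, ih]; push_cast; ring
  rw [Finset.sum_sub_distrib, ← Finset.mul_sum, h]
  simp
  ring

/-- A truncated geometric distribution on `{0, …, n}` with mean `n / 3` is the common marginal of
a measure on the triples with sum `n`. -/
theorem geomFun_mem {n : ℕ} (hn : 0 < n) {x : ℝ} (hx0 : 0 ≤ x) (hx1 : x ≤ 1)
    (hx : ∑ i ∈ Finset.range (n + 1), (3 * (i : ℝ) - n) * x ^ i = 0) :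
    geomFun n x ∈ marginalCone n := by
  obtain ⟨c, hc⟩ := geomFun_mem_modFlat hn hx0 hx1
  have h0 := sum_weight_eq_zero_of_mem hc
  have h1 : ∑ i ∈ Finset.range (n + 1), (3 * (i : ℝ) - n) * (geomFun n x + c • stepFun (n + 1)) i
      = c * (n * (n + 1) / 2) := by
    rw [← sum_range_weight, Finset.mul_sum, ← zero_add (∑ i ∈ _, c * _), ← hx,
      ← Finset.sum_add_distrib]
    refine Finset.sum_congr rfl fun i hi => ?_
    have hi' := Finset.mem_range.1 hi
    simp [geomFun, stepFun, hi']
    ring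
  have hn' : (0 : ℝ) < n := by exact_mod_cast hn
  -- The mean is `n / 3` on the cone and for the geometric sequence, but not for constants.
  have hc0 : c = 0 := by
    rw [h1] at h0
    rcases mul_eq_zero.1 h0 with h | h
    · exact h
    · exact absurd h (by positivity)
  simpa [hc0] using! hc

/-- A cyclically symmetric weight on the triples with sum `n` whose first marginal is the
truncated geometric sequence. -/
theorem exists_cyclic_weight {n : ℕ} (hn : 0 < n) {x : ℝ} (hx0 : 0 ≤ x) (hx1 : x ≤ 1)
    (hx : ∑ i ∈ Finset.range (n + 1), (3 * (i : ℝ) - n) * x ^ i = 0) :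
    ∃ w : ℕ × ℕ × ℕ → ℝ, (∀ t, 0 ≤ w t) ∧ (∀ a b c, w (a, b, c) = w (b, c, a)) ∧
      ∀ i ≤ n, ∑ t ∈ (triplesOfSum n).filter (fun t => t.1 = i), w t = x ^ i := by
  obtain ⟨w, hw, h⟩ := geomFun_mem hn hx0 hx1 hx
  refine ⟨fun t => w (t.1, t.2.1, t.2.2) + w (t.2.1, t.2.2, t.1) + w (t.2.2, t.1, t.2.1),
    fun t => add_nonneg (add_nonneg (hw _) (hw _)) (hw _), fun a b c => by ring, fun i hi => ?_⟩
  have hrot : ∀ g : ℕ × ℕ × ℕ → ℝ, ∑ t ∈ triplesOfSum n, g (t.2.1, t.2.2, t.1)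
      = ∑ t ∈ triplesOfSum n, g t := by
    intro g
    refine Finset.sum_bij' (fun t _ => (t.2.1, t.2.2, t.1)) (fun t _ => (t.2.2, t.1, t.2.1))
      ?_ ?_ ?_ ?_ ?_
    · intro t ht; rw [mem_triplesOfSum] at *; simp only; omega
    · intro t ht; rw [mem_triplesOfSum] at *; simp only; omega
    · intro t _; rfl
    · intro t _; rfl
    · intro t _; rfl
  have hi' := congrFun h i
  simp only [geomFun, if_pos (Nat.lt_succ_of_le hi), Finset.sum_apply, Pi.smul_apply,
    smul_eq_mul, entryCount, Pi.add_apply, mul_add, Finset.sum_add_distrib] at hi'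
  rw [hi', Finset.sum_filter]
  have e1 := hrot fun t => w (t.2.2, t.1, t.2.1) * (Pi.single t.2.2 1 : ℕ → ℝ) i
  have e2 := hrot fun t => w (t.2.1, t.2.2, t.1) * (Pi.single t.2.1 1 : ℕ → ℝ) i
  have e3 := hrot fun t => w (t.2.2, t.1, t.2.1) * (Pi.single t.2.2 1 : ℕ → ℝ) i
  have e4 := hrot fun t => w (t.1, t.2.1, t.2.2) * (Pi.single t.2.1 1 : ℕ → ℝ) i
  have e5 := hrot fun t => w (t.2.1, t.2.2, t.1) * (Pi.single t.2.2 1 : ℕ → ℝ) i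
  have e6 := hrot fun t => w (t.1, t.2.1, t.2.2) * (Pi.single t.2.2 1 : ℕ → ℝ) i
  have hsplit : ∀ t : ℕ × ℕ × ℕ, (if t.1 = i then w (t.1, t.2.1, t.2.2) + w (t.2.1, t.2.2, t.1)
      + w (t.2.2, t.1, t.2.1) else 0) = w (t.1, t.2.1, t.2.2) * (Pi.single t.1 1 : ℕ → ℝ) i
      + w (t.2.1, t.2.2, t.1) * (Pi.single t.1 1 : ℕ → ℝ) i
      + w (t.2.2, t.1, t.2.1) * (Pi.single t.1 1 : ℕ → ℝ) i := by
    intro t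
    by_cases ht : t.1 = i
    · subst ht; simp
    · simp [ht]
  rw [Finset.sum_congr rfl fun t _ => hsplit t, Finset.sum_add_distrib, Finset.sum_add_distrib]
  simp only at e1 e2 e3 e4 e5 e6
  linarith

/-! ### Free diagonals by affine hashing -/

/-- Two triples share a coordinate. -/
def ShareCoord {α : Type*} (s t : α × α × α) : Prop :=
  s.1 = t.1 ∨ s.2.1 = t.2.1 ∨ s.2.2 = t.2.2

instance {α : Type*} [DecidableEq α] (s t : α × α × α) : Decidable (ShareCoord s t) :=
  inferInstanceAs (Decidable (_ ∨ _ ∨ _))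

/-- A nonzero linear form on `F ^ ι` vanishes on at most a `1 / |F|` fraction of the space. -/
lemma card_filter_dotProduct_eq_zero {ι F : Type*} [Fintype ι] [DecidableEq ι] [Field F] [Fintype F]
    [DecidableEq F] {d : ι → F} (hd : d ≠ 0) :
    (Finset.univ.filter fun w : ι → F => w ⬝ᵥ d = 0).card * Fintype.card F
      ≤ Fintype.card (ι → F) := by
  obtain ⟨i, hi⟩ := Function.ne_iff.1 hd
  rw [← Finset.card_univ (α := F), ← Finset.card_product, ← Finset.card_univ]
  refine Finset.card_le_card_of_injOn (fun q => q.1 + Pi.single i q.2) (by simp) ?_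
  rintro ⟨w, a⟩ hw ⟨w', a'⟩ hw' h
  simp only [Finset.coe_product, Set.mem_prod, Finset.mem_coe, Finset.mem_filter,
    Finset.mem_univ, true_and, and_true] at hw hw' h
  have h2 := congrArg (fun q => q ⬝ᵥ d) h
  simp only [add_dotProduct, hw, hw', single_dotProduct, zero_add] at h2
  have h3 : a = a' := mul_right_cancel₀ hi h2
  subst h3
  rw [add_left_inj] at h
  rw [h]

section Hashing

variable {α ι F : Type*} [Fintype ι] [Field F] [DecidableEq F]

/-- The triples of `Φ` whose first two coordinates have the same hash value, lying in `S`. The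
hash functions are `x ↦ w ⬝ᵥ v x + u₁` and `y ↦ w ⬝ᵥ v y + u₂`, where `ω = (w, u₁, u₂)`. -/
def hashBucket (v : α → ι → F) (S : Finset F) (Φ : Finset (α × α × α)) (ω : (ι → F) × F × F) :
    Finset (α × α × α) :=
  Φ.filter fun t => ω.1 ⬝ᵥ v t.1 + ω.2.1 ∈ S ∧ ω.1 ⬝ᵥ v t.2.1 + ω.2.2 = ω.1 ⬝ᵥ v t.1 + ω.2.1

lemma mem_hashBucket {v : α → ι → F} {S : Finset F} {Φ : Finset (α × α × α)}
    {ω : (ι → F) × F × F} {t : α × α × α} :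
    t ∈ hashBucket v S Φ ω ↔ t ∈ Φ ∧ ω.1 ⬝ᵥ v t.1 + ω.2.1 ∈ S ∧
      ω.1 ⬝ᵥ v t.2.1 + ω.2.2 = ω.1 ⬝ᵥ v t.1 + ω.2.1 := Finset.mem_filter

variable [DecidableEq α]

/-- The triples of a finite set that share no coordinate with another element. -/
def isolatedTriples (X : Finset (α × α × α)) : Finset (α × α × α) :=
  X.filter fun t => ∀ s ∈ X, ShareCoord s t → s = t

lemma mem_isolatedTriples {X : Finset (α × α × α)} {t : α × α × α} :
    t ∈ isolatedTriples X ↔ t ∈ X ∧ ∀ s ∈ X, ShareCoord s t → s = t := Finset.mem_filter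

lemma isDiagonal_isolatedTriples (X : Finset (α × α × α)) :
    IsDiagonal (isolatedTriples X : Set (α × α × α)) := by
  intro s hs t ht hst
  simp only [isolatedTriples, Finset.coe_filter, Set.mem_ofPred_eq] at hs ht
  refine ⟨fun h => hst (ht.2 s hs.1 (Or.inl h)), fun h => hst (ht.2 s hs.1 (Or.inr (Or.inl h))),
    fun h => hst (ht.2 s hs.1 (Or.inr (Or.inr h)))⟩

/-- The hash values of a triple with `v x + v y + v z = c` form an arithmetic progression with
middle term a function of `z`. As `S` contains no proper progression, a triple whose coordinates
all occur in the bucket lies in the bucket. -/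
lemma mem_isolatedTriples_hashBucket {v : α → ι → F} {c : ι → F} {S : Finset F}
    (hS : ∀ a ∈ S, ∀ b ∈ S, ∀ e ∈ S, a + b = 2 * e → a = b) {Φ : Finset (α × α × α)}
    (hΦ : ∀ t ∈ Φ, v t.1 + v t.2.1 + v t.2.2 = c) (ω : (ι → F) × F × F) {t : α × α × α}
    (ht : t ∈ Φ)
    (h1 : ∃ s ∈ isolatedTriples (hashBucket v S Φ ω), s.1 = t.1)
    (h2 : ∃ s ∈ isolatedTriples (hashBucket v S Φ ω), s.2.1 = t.2.1)
    (h3 : ∃ s ∈ isolatedTriples (hashBucket v S Φ ω), s.2.2 = t.2.2) :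
    t ∈ isolatedTriples (hashBucket v S Φ ω) := by
  obtain ⟨s1, hs1, e1⟩ := h1
  obtain ⟨s2, hs2, e2⟩ := h2
  obtain ⟨s3, hs3, e3⟩ := h3
  have hs1' := hs1
  simp only [mem_isolatedTriples, mem_hashBucket] at hs1' hs2 hs3
  have key : ∀ s ∈ Φ, ω.1 ⬝ᵥ v s.1 + ω.1 ⬝ᵥ v s.2.1 + ω.1 ⬝ᵥ v s.2.2 = ω.1 ⬝ᵥ c := by
    intro s hs
    rw [← hΦ s hs, dotProduct_add, dotProduct_add]
  have k1 := key t ht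
  have k3 := key s3 hs3.1.1
  have m1 := hs1'.1.2.1
  have m2 := hs2.1.2.1
  rw [e1] at m1
  rw [← hs2.1.2.2, e2] at m2
  have q3 := hs3.1.2.2
  have hmem : t ∈ hashBucket v S Φ ω := by
    rw [mem_hashBucket]
    refine ⟨ht, m1, (hS _ m1 _ m2 _ hs3.1.2.1 ?_).symm⟩
    rw [e3] at k3
    linear_combination k1 - k3 + q3
  have : t = s1 := hs1'.2 t (mem_hashBucket.1 hmem) (Or.inl e1.symm)
  rw [this]; exact hs1

variable [DecidableEq ι] [Fintype F]

lemma card_filter_mem_hashBucket (v : α → ι → F) (S : Finset F) {Φ : Finset (α × α × α)}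
    {t : α × α × α} (ht : t ∈ Φ) :
    Fintype.card (ι → F) * S.card ≤
      (Finset.univ.filter fun ω : (ι → F) × F × F => t ∈ hashBucket v S Φ ω).card := by
  rw [← Finset.card_univ, ← Finset.card_product]
  refine Finset.card_le_card_of_injOn
    (fun q => (q.1, q.2 - q.1 ⬝ᵥ v t.1, q.2 - q.1 ⬝ᵥ v t.2.1)) ?_ ?_
  · rintro ⟨w, s⟩ hs
    simpa [hashBucket, ht] using hs
  · rintro ⟨w, s⟩ _ ⟨w', s'⟩ _ h
    simp only [Prod.mk.injEq] at h
    obtain ⟨rfl, h, -⟩ := h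
    simpa using h

/-- Two distinct triples that share a coordinate fall into the bucket together with probability
at most `|S| / |F| ^ 3`: their hash values agree, so that `w` lies in a hyperplane. -/
lemma card_filter_mem_mem_hashBucket {v : α → ι → F} (hv : Function.Injective v) {c : ι → F}
    (S : Finset F) {Φ : Finset (α × α × α)}
    (hΦ : ∀ t ∈ Φ, v t.1 + v t.2.1 + v t.2.2 = c) (h2 : (2 : F) ≠ 0) {s t : α × α × α}
    (hst : s ≠ t) (hsh : ShareCoord s t) :
    (Finset.univ.filter fun ω : (ι → F) × F × F =>
      s ∈ hashBucket v S Φ ω ∧ t ∈ hashBucket v S Φ ω).card * Fintype.card F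
      ≤ Fintype.card (ι → F) * S.card := by
  by_cases hs : s ∈ Φ
  swap
  · have : (Finset.univ.filter fun ω : (ι → F) × F × F =>
      s ∈ hashBucket v S Φ ω ∧ t ∈ hashBucket v S Φ ω) = ∅ := by
      simp [hashBucket, hs]
    rw [this]; simp
  by_cases ht : t ∈ Φ
  swap
  · have : (Finset.univ.filter fun ω : (ι → F) × F × F =>
      s ∈ hashBucket v S Φ ω ∧ t ∈ hashBucket v S Φ ω) = ∅ := by
      simp [hashBucket, ht]
    rw [this]; simp
  have hd : ∃ d : ι → F, d ≠ 0 ∧ ∀ ω : (ι → F) × F × F,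
      s ∈ hashBucket v S Φ ω → t ∈ hashBucket v S Φ ω → ω.1 ⬝ᵥ d = 0 := by
    have hval : ∀ ω : (ι → F) × F × F,
        s ∈ hashBucket v S Φ ω → t ∈ hashBucket v S Φ ω →
        ω.1 ⬝ᵥ (v s.1 - v t.1) = 0 ∧ ω.1 ⬝ᵥ (v s.2.1 - v t.2.1) = 0 := by
      intro ω h h'
      simp only [hashBucket, Finset.mem_filter] at h h'
      have a := h.2.2
      have b := h'.2.2
      have k := congrArg (fun q => ω.1 ⬝ᵥ q) ((hΦ s hs).trans (hΦ t ht).symm)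
      simp only [dotProduct_add] at k
      rw [dotProduct_sub, dotProduct_sub]
      have : ω.1 ⬝ᵥ v s.1 = ω.1 ⬝ᵥ v t.1 := by
        rcases hsh with e | e | e
        · rw [e]
        · rw [e] at a; linear_combination b - a
        · rw [e] at k
          refine mul_left_cancel₀ h2 ?_
          linear_combination k - a + b
      constructor
      · rw [this, sub_self]
      · linear_combination a - b + this
    by_cases e : v s.1 - v t.1 = 0
    · refine ⟨v s.2.1 - v t.2.1, fun e' => hst ?_, fun ω h h' => (hval ω h h').2⟩
      rw [sub_eq_zero] at e e'
      have k := (hΦ s hs).trans (hΦ t ht).symm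
      rw [e, e'] at k
      exact Prod.ext (hv e) (Prod.ext (hv e') (hv (add_left_cancel k)))
    · exact ⟨_, e, fun ω h h' => (hval ω h h').1⟩
  obtain ⟨d, hd0, hd⟩ := hd
  have hle : (Finset.univ.filter fun ω : (ι → F) × F × F =>
      s ∈ hashBucket v S Φ ω ∧ t ∈ hashBucket v S Φ ω).card ≤
      (Finset.univ.filter fun w : ι → F => w ⬝ᵥ d = 0).card * S.card := by
    rw [← Finset.card_product]
    refine Finset.card_le_card_of_injOn (fun ω => (ω.1, ω.1 ⬝ᵥ v s.1 + ω.2.1)) ?_ ?_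
    · intro ω hω
      simp only [Finset.coe_filter, Finset.mem_univ, true_and, Set.mem_ofPred_eq] at hω
      simp only [Finset.coe_product, Set.mem_prod, Finset.mem_coe, Finset.mem_filter,
        Finset.mem_univ, true_and]
      refine ⟨hd ω hω.1 hω.2, ?_⟩
      have := hω.1
      simp only [hashBucket, Finset.mem_filter] at this
      exact this.2.1
    · rintro ⟨w, u1, u2⟩ hω ⟨w', u1', u2'⟩ hω' h
      simp only [Finset.coe_filter, Finset.mem_univ, true_and, Set.mem_ofPred_eq, hashBucket,
        Finset.mem_filter] at hω hω'
      simp only [Prod.mk.injEq] at h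
      obtain ⟨rfl, h⟩ := h
      have q := hω.1.2.2
      have q' := hω'.1.2.2
      have e1 : u1 = u1' := add_left_cancel h
      subst e1
      have e2 : u2 = u2' := by linear_combination q - q'
      rw [e2]
  calc _ ≤ ((Finset.univ.filter fun w : ι → F => w ⬝ᵥ d = 0).card * S.card) * Fintype.card F :=
        Nat.mul_le_mul_right _ hle
    _ = ((Finset.univ.filter fun w : ι → F => w ⬝ᵥ d = 0).card * Fintype.card F) * S.card := by
        ring
    _ ≤ _ := Nat.mul_le_mul_right _ (card_filter_dotProduct_eq_zero hd0)

/-- A set of triples solving `v x + v y + v z = c`, with coordinate fibres of size at most `D`,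
contains a large diagonal that is induced: averaging over the hash functions, the isolated triples
of the bucket are at least as many as the triples less the conflicting pairs. -/
theorem exists_induced_diagonal {v : α → ι → F} (hv : Function.Injective v) {c : ι → F}
    {S : Finset F} (hS : ∀ a ∈ S, ∀ b ∈ S, ∀ e ∈ S, a + b = 2 * e → a = b)
    {Φ : Finset (α × α × α)} (hΦ : ∀ t ∈ Φ, v t.1 + v t.2.1 + v t.2.2 = c) (h2 : (2 : F) ≠ 0)
    {D : ℕ} (hD1 : ∀ x, (Φ.filter fun t => t.1 = x).card ≤ D)
    (hD2 : ∀ x, (Φ.filter fun t => t.2.1 = x).card ≤ D)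
    (hD3 : ∀ x, (Φ.filter fun t => t.2.2 = x).card ≤ D) :
    ∃ Γ ⊆ Φ, IsDiagonal (Γ : Set (α × α × α)) ∧
      (∀ t ∈ Φ, (∃ s ∈ Γ, s.1 = t.1) → (∃ s ∈ Γ, s.2.1 = t.2.1) → (∃ s ∈ Γ, s.2.2 = t.2.2) →
        t ∈ Γ) ∧
      Φ.card * S.card * Fintype.card F ≤
        Γ.card * Fintype.card F ^ 3 + 3 * D * Φ.card * S.card := by
  set q := Fintype.card F with hq
  set V := Fintype.card (ι → F) with hV
  let P : Finset ((α × α × α) × (α × α × α)) :=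
    (Φ ×ˢ Φ).filter fun e => e.1 ≠ e.2 ∧ ShareCoord e.1 e.2
  have hP : P.card ≤ 3 * D * Φ.card := by
    have : P.card = ∑ t ∈ Φ, (Φ.filter fun s => s ≠ t ∧ ShareCoord s t).card := by
      simp only [P, Finset.card_filter]
      rw [Finset.sum_product_right]
    rw [this, mul_comm (3 * D), ← smul_eq_mul]
    refine Finset.sum_le_card_nsmul _ _ _ fun t _ => ?_
    calc (Φ.filter fun s => s ≠ t ∧ ShareCoord s t).card
        ≤ ((Φ.filter fun s => s.1 = t.1) ∪ ((Φ.filter fun s => s.2.1 = t.2.1) ∪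
            (Φ.filter fun s => s.2.2 = t.2.2))).card := by
          refine Finset.card_le_card fun s hs => ?_
          simp only [Finset.mem_filter, Finset.mem_union] at hs ⊢
          obtain ⟨h0, -, h | h | h⟩ := hs <;> simp [h0, h]
      _ ≤ D + (D + D) := by
          refine (Finset.card_union_le _ _).trans (add_le_add (hD1 _) ?_)
          exact (Finset.card_union_le _ _).trans (add_le_add (hD2 _) (hD3 _))
      _ = 3 * D := by ring
  have hX : Φ.card * (V * S.card) ≤
      ∑ ω : (ι → F) × F × F, (hashBucket v S Φ ω).card := by
    have : ∀ ω : (ι → F) × F × F, (hashBucket v S Φ ω).card =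
        ∑ t ∈ Φ, if t ∈ hashBucket v S Φ ω then 1 else 0 := by
      intro ω
      rw [← Finset.card_filter]
      congr 1
      ext t
      simp only [hashBucket, Finset.mem_filter]
      tauto
    simp only [this]
    rw [Finset.sum_comm, ← smul_eq_mul]
    refine Finset.card_nsmul_le_sum _ _ _ fun t ht => ?_
    rw [← Finset.card_filter]
    exact card_filter_mem_hashBucket v S ht
  have hbad : ∀ ω : (ι → F) × F × F, (hashBucket v S Φ ω).card ≤
      (isolatedTriples (hashBucket v S Φ ω)).card +
        (P.filter fun e => e.1 ∈ hashBucket v S Φ ω ∧ e.2 ∈ hashBucket v S Φ ω).card := by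
    intro ω
    set X := hashBucket v S Φ ω with hXdef
    have hXΦ : X ⊆ Φ := Finset.filter_subset _ _
    rw [← Finset.card_filter_add_card_filter_not (s := X)
      (fun t => ∀ s ∈ X, ShareCoord s t → s = t)]
    refine add_le_add le_rfl ?_
    have : (X.filter fun t => ¬ ∀ s ∈ X, ShareCoord s t → s = t) ⊆
        (P.filter fun e => e.1 ∈ X ∧ e.2 ∈ X).image Prod.snd := by
      intro t ht
      simp only [Finset.mem_filter, not_forall] at ht
      obtain ⟨ht, s, hs, hsh, hne⟩ := ht
      refine Finset.mem_image.2 ⟨(s, t), ?_, rfl⟩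
      simp only [P, Finset.mem_filter, Finset.mem_product]
      exact ⟨⟨⟨hXΦ hs, hXΦ ht⟩, hne, hsh⟩, hs, ht⟩
    exact (Finset.card_le_card this).trans Finset.card_image_le
  have hconf : (∑ ω : (ι → F) × F × F,
      (P.filter fun e => e.1 ∈ hashBucket v S Φ ω ∧ e.2 ∈ hashBucket v S Φ ω).card) * q ≤
      3 * D * Φ.card * (V * S.card) := by
    simp only [Finset.card_filter]
    rw [Finset.sum_comm, Finset.sum_mul]
    calc _ ≤ ∑ e ∈ P, V * S.card := by
          refine Finset.sum_le_sum fun e he => ?_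
          rw [← Finset.card_filter]
          simp only [P, Finset.mem_filter] at he
          exact card_filter_mem_mem_hashBucket hv S hΦ h2 he.2.1 he.2.2
      _ = P.card * (V * S.card) := by rw [Finset.sum_const, smul_eq_mul]
      _ ≤ _ := Nat.mul_le_mul_right _ hP
  by_contra! hcon
  have hΓ : ∀ ω : (ι → F) × F × F,
      (isolatedTriples (hashBucket v S Φ ω)).card * q ^ 3 + 3 * D * Φ.card * S.card
        < Φ.card * S.card * q := fun ω =>
    hcon _ ((Finset.filter_subset _ _).trans (Finset.filter_subset _ _))
      (isDiagonal_isolatedTriples _)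
      fun t ht h1 h2 h3 => mem_isolatedTriples_hashBucket hS hΦ ω ht h1 h2 h3
  have hne : (Finset.univ : Finset ((ι → F) × F × F)).Nonempty := ⟨0, Finset.mem_univ _⟩
  have hsum := Finset.sum_lt_sum_of_nonempty hne fun ω _ => hΓ ω
  rw [Finset.sum_add_distrib, ← Finset.sum_mul, Finset.sum_const, Finset.sum_const,
    Finset.card_univ, Fintype.card_prod, Fintype.card_prod, smul_eq_mul, smul_eq_mul, ← hq,
    ← hV] at hsum
  have htot := Finset.sum_le_sum fun (ω : (ι → F) × F × F) (_ : ω ∈ Finset.univ) => hbad ω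
  rw [Finset.sum_add_distrib] at htot
  have hq0 : 0 < q := Fintype.card_pos
  have h1 := Nat.mul_le_mul_right (q ^ 3) (hX.trans htot)
  have h3 := Nat.mul_le_mul_right (q ^ 2) hconf
  rw [add_mul] at h1
  have e1 : V * (q * q) * (Φ.card * S.card * q) = Φ.card * (V * S.card) * q ^ 3 := by ring
  have e2 : V * (q * q) * (3 * D * Φ.card * S.card) = 3 * D * Φ.card * (V * S.card) * q ^ 2 := by
    ring
  rw [e1, e2] at hsum
  have e3 : ∀ A : ℕ, A * q ^ 3 = A * q * q ^ 2 := fun A => by ring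
  rw [e3 (∑ ω : (ι → F) × F × F,
      (P.filter fun e => e.1 ∈ hashBucket v S Φ ω ∧ e.2 ∈ hashBucket v S Φ ω).card)] at h1
  omega

end Hashing

/-- A progression-free set of integers below `(M + 1) / 2` stays progression-free modulo `M`. -/
lemma exists_progressionFree_zmod {M : ℕ} [NeZero M] :
    ∃ S : Finset (ZMod M), S.card = rothNumberNat ((M + 1) / 2) ∧
      ∀ a ∈ S, ∀ b ∈ S, ∀ e ∈ S, a + b = 2 * e → a = b := by
  obtain ⟨T, hT, hcard, hfree⟩ := rothNumberNat_spec ((M + 1) / 2)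
  have hlt : ∀ a ∈ T, 2 * a < M := fun a ha => by
    have := Finset.mem_range.1 (hT ha); omega
  refine ⟨T.image fun a : ℕ => (a : ZMod M), ?_, ?_⟩
  · rw [Finset.card_image_of_injOn, hcard]
    intro a ha b hb h
    simp only [ZMod.natCast_eq_natCast_iff] at h
    have h1 := hlt a ha
    have h2 := hlt b hb
    exact Nat.ModEq.eq_of_lt_of_lt h (by omega) (by omega)
  · simp only [Finset.mem_image]
    rintro _ ⟨a, ha, rfl⟩ _ ⟨b, hb, rfl⟩ _ ⟨e, he, rfl⟩ h
    have h1 := hlt a ha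
    have h2 := hlt b hb
    have h3 := hlt e he
    have h' : ((a + b : ℕ) : ZMod M) = ((2 * e : ℕ) : ZMod M) := by push_cast; exact h
    rw [ZMod.natCast_eq_natCast_iff] at h'
    have h4 : a + b = 2 * e := Nat.ModEq.eq_of_lt_of_lt h' (by omega) (by omega)
    have h5 : a = e := hfree ha he hb (by omega)
    have : a = b := by omega
    rw [this]

/-- A set of triples of bounded integer vectors with constant sum and with coordinate fibres of
size at most `D` contains an induced diagonal of size about `|Φ| / D`. -/
theorem exists_large_induced_diagonal {α ι : Type*} [DecidableEq α] [Fintype ι] [DecidableEq ι]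
    {n D : ℕ} (hD : 0 < D) {v : α → ι → ℕ} (hv : Function.Injective v) (hvn : ∀ x i, v x i ≤ n)
    {Φ : Finset (α × α × α)} (hΦ : ∀ t ∈ Φ, ∀ i, v t.1 i + v t.2.1 i + v t.2.2 i = n)
    (hD1 : ∀ x, (Φ.filter fun t => t.1 = x).card ≤ D)
    (hD2 : ∀ x, (Φ.filter fun t => t.2.1 = x).card ≤ D)
    (hD3 : ∀ x, (Φ.filter fun t => t.2.2 = x).card ≤ D) :
    ∃ Γ ⊆ Φ, IsDiagonal (Γ : Set (α × α × α)) ∧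
      (∀ t ∈ Φ, (∃ s ∈ Γ, s.1 = t.1) → (∃ s ∈ Γ, s.2.1 = t.2.1) → (∃ s ∈ Γ, s.2.2 = t.2.2) →
        t ∈ Γ) ∧
      (Φ.card : ℝ) * Real.exp (-4 * √(Real.log (12 * (D + n)))) ≤ 48 * (D + n) * Γ.card := by
  obtain ⟨M, hM, hlt, hle⟩ := Nat.exists_prime_lt_and_le_two_mul (6 * (D + n)) (by omega)
  have : Fact M.Prime := ⟨hM⟩
  obtain ⟨S, hScard, hS⟩ := exists_progressionFree_zmod (M := M)
  have hinj : Function.Injective fun (x : α) (i : ι) => (v x i : ZMod M) := by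
    intro x y h
    refine hv (funext fun i => ?_)
    have := congrFun h i
    simp only [ZMod.natCast_eq_natCast_iff] at this
    have h1 := hvn x i
    have h2 := hvn y i
    exact Nat.ModEq.eq_of_lt_of_lt this (by omega) (by omega)
  have h2 : (2 : ZMod M) ≠ 0 := by
    have : ((2 : ℕ) : ZMod M) ≠ 0 := by
      rw [Ne, ZMod.natCast_eq_zero_iff]
      intro h
      have := Nat.le_of_dvd (by norm_num) h
      omega
    exact_mod_cast this
  obtain ⟨Γ, hΓ, hdiag, hind, hcount⟩ := exists_induced_diagonal (c := fun _ => (n : ZMod M)) hinj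
    hS (Φ := Φ) (by
      intro t ht
      funext i
      simp only [Pi.add_apply]
      rw [← hΦ t ht i]
      push_cast
      ring) h2 hD1 hD2 hD3
  refine ⟨Γ, hΓ, hdiag, hind, ?_⟩
  rw [ZMod.card, hScard] at hcount
  have hB := Behrend.roth_lower_bound (N := (M + 1) / 2)
  set R := rothNumberNat ((M + 1) / 2)
  have hMpos : (0 : ℝ) < M := by exact_mod_cast hM.pos
  have hhalf : (M : ℝ) / 2 ≤ (((M + 1) / 2 : ℕ) : ℝ) := by
    have : M ≤ 2 * ((M + 1) / 2) := by omega
    have h : (M : ℝ) ≤ 2 * (((M + 1) / 2 : ℕ) : ℝ) := by exact_mod_cast this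
    linarith
  have hMle : (M : ℝ) ≤ 12 * (D + n) := by
    have : M ≤ 12 * (D + n) := by omega
    exact_mod_cast this
  have hNle : (((M + 1) / 2 : ℕ) : ℝ) ≤ 12 * (D + n) := by
    have : (M + 1) / 2 ≤ 12 * (D + n) := by omega
    exact_mod_cast this
  set E := Real.exp (-4 * √(Real.log (12 * (D + n)))) with hE
  have hexp : E ≤ Real.exp (-4 * √(Real.log (((M + 1) / 2 : ℕ) : ℝ))) := by
    refine Real.exp_le_exp.2 ?_
    have : √(Real.log (((M + 1) / 2 : ℕ) : ℝ)) ≤ √(Real.log (12 * (D + n))) :=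
      Real.sqrt_le_sqrt (Real.log_le_log (by linarith) hNle)
    linarith
  have hR : (M : ℝ) / 2 * E ≤ R :=
    (mul_le_mul hhalf hexp (Real.exp_pos _).le (by positivity)).trans hB
  have hD6 : (6 : ℝ) * D ≤ M := by
    have : 6 * D ≤ M := by omega
    exact_mod_cast this
  have hc : (Φ.card : ℝ) * R * M ≤ Γ.card * M ^ 3 + 3 * D * Φ.card * R := by exact_mod_cast hcount
  have h3 : (Φ.card : ℝ) * R * (M / 2) ≤ Γ.card * M ^ 3 := by
    have : (0 : ℝ) ≤ Φ.card * R := by positivity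
    nlinarith
  have h4 : (Φ.card : ℝ) * (M / 2 * E) * (M / 2) ≤ Γ.card * M ^ 3 := by
    refine le_trans ?_ h3
    gcongr
  have h5 : (Φ.card : ℝ) * E ≤ 4 * M * Γ.card := by
    have hM2 : (0 : ℝ) < M ^ 2 / 4 := by positivity
    refine le_of_mul_le_mul_right ?_ hM2
    calc (Φ.card : ℝ) * E * (M ^ 2 / 4) = Φ.card * (M / 2 * E) * (M / 2) := by ring
      _ ≤ _ := h4
      _ = _ := by ring
  calc (Φ.card : ℝ) * E ≤ 4 * M * Γ.card := h5
    _ ≤ 4 * (12 * (D + n)) * Γ.card := by gcongr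
    _ = _ := by ring

/-! ### The maximal size of a tricolored sum-free set -/

lemma IsTricoloredSumFree.ncard_le_maxTricolored {G : Type*} [AddCommGroup G] [Finite G]
    {Γ : Set (G × G × G)} (h : IsTricoloredSumFree Γ) : Γ.ncard ≤ maxTricolored G := by
  refine le_csSup ⟨Nat.card (G × G × G), ?_⟩ ⟨Γ, h, rfl⟩
  rintro _ ⟨Δ, -, rfl⟩
  exact Set.ncard_le_card Δ

lemma exists_ncard_eq_maxTricolored (G : Type*) [AddCommGroup G] [Finite G] :
    ∃ Γ : Set (G × G × G), IsTricoloredSumFree Γ ∧ Γ.ncard = maxTricolored G := by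
  refine Nat.sSup_mem (s := {k : ℕ | ∃ Γ : Set (G × G × G), IsTricoloredSumFree Γ ∧ Γ.ncard = k})
    ⟨0, ∅, ?_, Set.ncard_empty _⟩ ⟨Nat.card (G × G × G), ?_⟩
  · exact ⟨fun α hα => absurd hα (by simp), fun x ⟨α, hα, _⟩ => absurd hα (by simp)⟩
  · rintro _ ⟨Δ, -, rfl⟩
    exact Set.ncard_le_card Δ

/-- Injective relabellings of the three coordinates of a diagonal give a tricolored sum-free set
as soon as the labels sum to zero exactly on the diagonal. -/
lemma ncard_le_maxTricolored_of_relabelling {α G : Type*} [AddCommGroup G] [Finite G]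
    {Γ : Set (α × α × α)} (hΓ : IsDiagonal Γ) {f₁ f₂ f₃ : α → G} (h₁ : Function.Injective f₁)
    (h₂ : Function.Injective f₂) (h₃ : Function.Injective f₃)
    (h : ∀ a ∈ Γ, ∀ b ∈ Γ, ∀ c ∈ Γ,
      (f₁ a.1 + f₂ b.2.1 + f₃ c.2.2 = 0 ↔ (a.1, b.2.1, c.2.2) ∈ Γ)) :
    Γ.ncard ≤ maxTricolored G := by
  have hinj : Function.Injective (Prod.map f₁ (Prod.map f₂ f₃)) := h₁.prodMap (h₂.prodMap h₃)
  rw [← Set.ncard_image_of_injective Γ hinj]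
  refine IsTricoloredSumFree.ncard_le_maxTricolored ⟨?_, ?_⟩
  · rintro _ ⟨s, hs, rfl⟩ _ ⟨t, ht, rfl⟩ hst
    have := hΓ s hs t ht (fun h => hst (by rw [h]))
    exact ⟨fun e => this.1 (h₁ e), fun e => this.2.1 (h₂ e), fun e => this.2.2 (h₃ e)⟩
  · rintro _ ⟨_, ⟨a, ha, rfl⟩, rfl⟩ _ ⟨_, ⟨b, hb, rfl⟩, rfl⟩ _ ⟨_, ⟨c, hc, rfl⟩, rfl⟩
    refine (h a ha b hb c hc).trans ?_
    exact (hinj.mem_set_image (s := Γ) (a := (a.1, b.2.1, c.2.2))).symm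

lemma maxTricolored_le_of_injective {G H : Type*} [AddCommGroup G] [Finite G] [AddCommGroup H]
    [Finite H] (f : G →+ H) (hf : Function.Injective f) : maxTricolored G ≤ maxTricolored H := by
  obtain ⟨Γ, hΓ, hcard⟩ := exists_ncard_eq_maxTricolored G
  rw [← hcard]
  refine ncard_le_maxTricolored_of_relabelling hΓ.1 hf hf hf fun a ha b hb c hc => ?_
  rw [← map_add, ← map_add, map_eq_zero_iff f hf]
  exact hΓ.2 _ ⟨a, ha, rfl⟩ _ ⟨b, hb, rfl⟩ _ ⟨c, hc, rfl⟩

lemma maxTricolored_pi_mono {ι κ G : Type*} [Finite ι] [Finite κ] [AddCommGroup G] [Finite G]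
    (f : ι ↪ κ) : maxTricolored (ι → G) ≤ maxTricolored (κ → G) := by
  refine maxTricolored_le_of_injective
    { toFun := fun x => Function.extend f x 0
      map_zero' := Function.extend_zero f
      map_add' := fun x y => ?_ } ?_
  · rw [← Function.extend_add, add_zero]
  · intro x y h
    funext i
    have := congrFun h (f i)
    simpa [f.injective.extend_apply] using this

/-! ### Type classes -/

section TypeClass

variable {ι : Type*} [Fintype ι] [DecidableEq ι] {m : ℕ}

/-- The words with the same letter frequencies as `x₀`, that is, its rearrangements. -/
def typeClass (x₀ : ι → Fin m) : Finset (ι → Fin m) :=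
  Finset.univ.image fun σ : Equiv.Perm ι => x₀ ∘ σ

/-- The triples of rearrangements of `x₀` with pointwise sum `m - 1`. -/
def typeClassTriples (x₀ : ι → Fin m) :
    Finset ((ι → Fin m) × (ι → Fin m) × (ι → Fin m)) :=
  (typeClass x₀ ×ˢ typeClass x₀ ×ˢ typeClass x₀).filter
    fun t => ∀ i, (t.1 i : ℕ) + t.2.1 i + t.2.2 i = m - 1

lemma mem_typeClassTriples {x₀ : ι → Fin m} {t : (ι → Fin m) × (ι → Fin m) × (ι → Fin m)} :
    t ∈ typeClassTriples x₀ ↔ (t.1 ∈ typeClass x₀ ∧ t.2.1 ∈ typeClass x₀ ∧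
      t.2.2 ∈ typeClass x₀) ∧ ∀ i, (t.1 i : ℕ) + t.2.1 i + t.2.2 i = m - 1 := by
  simp [typeClassTriples]

lemma comp_perm_mem_typeClass {x₀ x : ι → Fin m} (hx : x ∈ typeClass x₀) (σ : Equiv.Perm ι) :
    x ∘ σ ∈ typeClass x₀ := by
  simp only [typeClass, Finset.mem_image, Finset.mem_univ, true_and] at hx ⊢
  obtain ⟨τ, rfl⟩ := hx
  exact ⟨σ.trans τ, rfl⟩

lemma sum_eq_of_mem_typeClass {x₀ x : ι → Fin m} (hx : x ∈ typeClass x₀) :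
    ∑ i, (x i : ℕ) = ∑ i, (x₀ i : ℕ) := by
  simp only [typeClass, Finset.mem_image, Finset.mem_univ, true_and] at hx
  obtain ⟨τ, rfl⟩ := hx
  exact Equiv.sum_comp τ fun i => (x₀ i : ℕ)

lemma card_fibre_le_card_fibre_comp (x₀ x : ι → Fin m) (σ : Equiv.Perm ι) :
    ((typeClassTriples x₀).filter fun t => t.1 = x).card ≤
      ((typeClassTriples x₀).filter fun t => t.1 = x ∘ σ).card := by
  refine Finset.card_le_card_of_injOn (fun t => (t.1 ∘ σ, t.2.1 ∘ σ, t.2.2 ∘ σ)) ?_ ?_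
  · intro t ht
    simp only [Finset.coe_filter, Set.mem_ofPred_eq, mem_typeClassTriples] at ht ⊢
    obtain ⟨⟨⟨h1, h2, h3⟩, h⟩, rfl⟩ := ht
    exact ⟨⟨⟨comp_perm_mem_typeClass h1 σ, comp_perm_mem_typeClass h2 σ,
      comp_perm_mem_typeClass h3 σ⟩, fun i => h (σ i)⟩, rfl⟩
  · rintro ⟨a, b, c⟩ _ ⟨a', b', c'⟩ _ h
    simp only [Prod.mk.injEq] at h
    have hs := σ.surjective.injective_comp_right (γ := Fin m)
    rw [hs h.1, hs h.2.1, hs h.2.2]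

lemma card_fibre_snd_le (x₀ y : ι → Fin m) :
    ((typeClassTriples x₀).filter fun t => t.2.1 = y).card ≤
      ((typeClassTriples x₀).filter fun t => t.1 = y).card := by
  refine Finset.card_le_card_of_injOn (fun t => (t.2.1, t.2.2, t.1)) ?_ ?_
  · intro t ht
    simp only [Finset.coe_filter, Set.mem_ofPred_eq, mem_typeClassTriples] at ht ⊢
    obtain ⟨⟨⟨h1, h2, h3⟩, h⟩, rfl⟩ := ht
    exact ⟨⟨⟨h2, h3, h1⟩, fun i => by rw [← h i]; ring⟩, rfl⟩
  · rintro ⟨a, b, c⟩ _ ⟨a', b', c'⟩ _ h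
    simp only [Prod.mk.injEq] at h ⊢
    tauto

lemma card_fibre_trd_le (x₀ z : ι → Fin m) :
    ((typeClassTriples x₀).filter fun t => t.2.2 = z).card ≤
      ((typeClassTriples x₀).filter fun t => t.1 = z).card := by
  refine Finset.card_le_card_of_injOn (fun t => (t.2.2, t.1, t.2.1)) ?_ ?_
  · intro t ht
    simp only [Finset.coe_filter, Set.mem_ofPred_eq, mem_typeClassTriples] at ht ⊢
    obtain ⟨⟨⟨h1, h2, h3⟩, h⟩, rfl⟩ := ht
    exact ⟨⟨⟨h3, h1, h2⟩, fun i => by rw [← h i]; ring⟩, rfl⟩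
  · rintro ⟨a, b, c⟩ _ ⟨a', b', c'⟩ _ h
    simp only [Prod.mk.injEq] at h ⊢
    tauto

lemma card_fibre_eq {x₀ x : ι → Fin m} (hx : x ∈ typeClass x₀) :
    ((typeClassTriples x₀).filter fun t => t.1 = x).card =
      ((typeClassTriples x₀).filter fun t => t.1 = x₀).card := by
  simp only [typeClass, Finset.mem_image, Finset.mem_univ, true_and] at hx
  obtain ⟨σ, rfl⟩ := hx
  refine le_antisymm ?_ (card_fibre_le_card_fibre_comp x₀ x₀ σ)
  have := card_fibre_le_card_fibre_comp x₀ (x₀ ∘ σ) σ⁻¹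
  have e : (x₀ ∘ σ) ∘ (σ⁻¹ : Equiv.Perm ι) = x₀ := by
    funext i; simp
  rwa [e] at this

lemma card_fibre_le (x₀ x : ι → Fin m) :
    ((typeClassTriples x₀).filter fun t => t.1 = x).card ≤
      ((typeClassTriples x₀).filter fun t => t.1 = x₀).card := by
  by_cases hx : x ∈ typeClass x₀
  · exact (card_fibre_eq hx).le
  · rw [Finset.card_eq_zero.2]
    · exact Nat.zero_le _
    · rw [Finset.filter_eq_empty_iff]
      rintro t ht rfl
      exact hx (mem_typeClassTriples.1 ht).1.1

lemma card_typeClassTriples (x₀ : ι → Fin m) :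
    (typeClassTriples x₀).card = (typeClass x₀).card *
      ((typeClassTriples x₀).filter fun t => t.1 = x₀).card := by
  rw [Finset.card_eq_sum_card_fiberwise (f := Prod.fst) (t := typeClass x₀)
    fun t ht => (mem_typeClassTriples.1 ht).1.1, ← smul_eq_mul, ← Finset.sum_const]
  exact Finset.sum_congr rfl fun x hx => card_fibre_eq hx

open Nat in
lemma factorial_le_card_typeClass_mul (x₀ : ι → Fin m) :
    (Fintype.card ι)! ≤ (typeClass x₀).card *
      ∏ i : Fin m, (Fintype.card {a // x₀ a = i})! := by
  rw [← Fintype.card_perm, ← Finset.card_univ, ← DomMulAct.stabilizer_card,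
    Finset.card_eq_sum_card_fiberwise (f := fun σ : Equiv.Perm ι => x₀ ∘ σ) (t := typeClass x₀)
      fun σ _ => Finset.mem_image_of_mem _ (Finset.mem_univ σ), ← smul_eq_mul, ← Finset.sum_const]
  refine Finset.sum_le_sum fun x hx => ?_
  obtain ⟨τ, -, rfl⟩ := Finset.mem_image.1 hx
  rw [Fintype.card_subtype]
  refine Finset.card_le_card_of_injOn (fun σ => τ⁻¹.trans σ) ?_ ?_
  · intro σ hσ
    simp only [Finset.coe_filter, Finset.mem_univ, true_and, Set.mem_ofPred_eq] at hσ ⊢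
    funext i
    have := congrFun hσ (τ⁻¹ i)
    simpa using this
  · intro σ _ σ' _ h
    ext i
    have := congrArg (fun g : Equiv.Perm ι => g (τ i)) h
    simpa using this

/-- Three rearrangements of a word whose sums are `m - 1` modulo `m` at every position have sums
`m - 1` at every position: no position can exceed, as the total is fixed. -/
lemma mem_typeClassTriples_of_modEq [NeZero m] {x₀ : ι → Fin m}
    (hne : (typeClassTriples x₀).Nonempty)
    {x y z : ι → Fin m} (hx : x ∈ typeClass x₀) (hy : y ∈ typeClass x₀) (hz : z ∈ typeClass x₀)
    (h : ∀ i, (x i : ℕ) + y i + z i ≡ m - 1 [MOD m]) : (x, y, z) ∈ typeClassTriples x₀ := by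
  refine mem_typeClassTriples.2 ⟨⟨hx, hy, hz⟩, ?_⟩
  obtain ⟨t, ht⟩ := hne
  obtain ⟨⟨h1, h2, h3⟩, h4⟩ := mem_typeClassTriples.1 ht
  have hm : 0 < m := Nat.pos_of_ne_zero (NeZero.ne m)
  have hge : ∀ i ∈ Finset.univ, m - 1 ≤ (x i : ℕ) + y i + z i := by
    intro i _
    have := h i
    rw [Nat.ModEq, Nat.mod_eq_of_lt (by omega : m - 1 < m)] at this
    calc m - 1 = ((x i : ℕ) + y i + z i) % m := this.symm
      _ ≤ _ := Nat.mod_le _ _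
  have hsum : ∑ i : ι, (m - 1) = ∑ i, ((x i : ℕ) + y i + z i) := by
    rw [Finset.sum_congr rfl fun i _ => (h4 i).symm]
    simp only [Finset.sum_add_distrib]
    rw [sum_eq_of_mem_typeClass h1, sum_eq_of_mem_typeClass h2, sum_eq_of_mem_typeClass h3,
      sum_eq_of_mem_typeClass hx, sum_eq_of_mem_typeClass hy, sum_eq_of_mem_typeClass hz]
  have := (Finset.sum_eq_sum_iff_of_le hge).1 hsum
  exact fun i => (this i (Finset.mem_univ i)).symm

open Nat in
/-- A word whose rotations under a permutation of the positions sum to `m - 1` yields tricolored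
sum-free sets of about the size of its type class. -/
theorem factorial_le_maxTricolored [NeZero m] (x₀ : ι → Fin m) (ρ : Equiv.Perm ι)
    (h : ∀ i, (x₀ i : ℕ) + x₀ (ρ i) + x₀ (ρ (ρ i)) = m - 1) :
    ((Fintype.card ι)! : ℝ) *
        Real.exp (-4 * √(Real.log (12 * ((m : ℝ) ^ (3 * Fintype.card ι) * m)))) ≤
      48 * m * maxTricolored (ι → ZMod m) *
        ∏ i : Fin m, ((Fintype.card {a // x₀ a = i})! : ℝ) := by
  have hm : 0 < m := Nat.pos_of_ne_zero (NeZero.ne m)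
  have hself : x₀ ∈ typeClass x₀ := Finset.mem_image.2 ⟨1, Finset.mem_univ _, rfl⟩
  have hmem : (x₀, x₀ ∘ ρ, x₀ ∘ ρ ∘ ρ) ∈ typeClassTriples x₀ :=
    mem_typeClassTriples.2 ⟨⟨hself, comp_perm_mem_typeClass hself ρ,
      comp_perm_mem_typeClass (comp_perm_mem_typeClass hself ρ) ρ⟩, h⟩
  set Φ := typeClassTriples x₀ with hΦ
  set D := (Φ.filter fun t => t.1 = x₀).card with hDdef
  have hD : 0 < D := Finset.card_pos.2 ⟨_, Finset.mem_filter.2 ⟨hmem, rfl⟩⟩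
  have hDle : D ≤ m ^ (3 * Fintype.card ι) := by
    refine (Finset.card_le_univ _).trans_eq ?_
    simp only [Fintype.card_prod, Fintype.card_fun, Fintype.card_fin]
    ring
  obtain ⟨Γ, hΓ, hdiag, hind, hcard⟩ := exists_large_induced_diagonal (n := m - 1) hD
    (v := fun (x : ι → Fin m) i => (x i : ℕ))
    (fun x y hxy => funext fun i => Fin.ext (congrFun hxy i)) (fun x i => by have := (x i).2; omega)
    (Φ := Φ) (fun t ht => (mem_typeClassTriples.1 ht).2) (card_fibre_le x₀)
    (fun y => (card_fibre_snd_le x₀ y).trans (card_fibre_le x₀ y))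
    (fun z => (card_fibre_trd_le x₀ z).trans (card_fibre_le x₀ z))
  have hcastinj : Function.Injective fun (x : ι → Fin m) (i : ι) => ((x i : ℕ) : ZMod m) := by
    intro x y hxy
    funext i
    have := congrFun hxy i
    simp only [ZMod.natCast_eq_natCast_iff] at this
    exact Fin.ext (Nat.ModEq.eq_of_lt_of_lt this (x i).2 (y i).2)
  have hmax : Γ.card ≤ maxTricolored (ι → ZMod m) := by
    rw [← Set.ncard_coe_finset]
    -- Shifting the third coordinate by one turns the sums `m - 1` into `m = 0`.
    refine ncard_le_maxTricolored_of_relabelling hdiag hcastinj hcastinj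
      (f₃ := fun x i => ((x i : ℕ) : ZMod m) + 1)
      (fun x y hxy => hcastinj (funext fun i => add_right_cancel (congrFun hxy i)))
      fun a ha b hb c hc => ?_
    have hmod : ∀ i, ((a.1 i : ℕ) + b.2.1 i + c.2.2 i ≡ m - 1 [MOD m]) ↔
        ((a.1 i : ℕ) : ZMod m) + (b.2.1 i : ℕ) + ((c.2.2 i : ℕ) + 1) = 0 := by
      intro i
      rw [← ZMod.natCast_eq_natCast_iff, ← add_left_inj (1 : ZMod m)]
      have : ((m - 1 : ℕ) : ZMod m) + 1 = 0 := by
        have e : ((m - 1 + 1 : ℕ) : ZMod m) = 0 := by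
          rw [Nat.sub_add_cancel hm, ZMod.natCast_self]
        exact_mod_cast e
      rw [this]
      push_cast
      rw [add_assoc (_ + _)]
    have ha' := (mem_typeClassTriples.1 (hΓ ha)).1.1
    have hb' := (mem_typeClassTriples.1 (hΓ hb)).1.2.1
    have hc' := (mem_typeClassTriples.1 (hΓ hc)).1.2.2
    constructor
    · intro h0
      refine hind _ (mem_typeClassTriples_of_modEq ⟨_, hmem⟩ ha' hb' hc' fun i => ?_)
        ⟨a, ha, rfl⟩ ⟨b, hb, rfl⟩ ⟨c, hc, rfl⟩
      exact (hmod i).2 (congrFun h0 i)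
    · intro h0
      funext i
      refine (hmod i).1 ?_
      have := (mem_typeClassTriples.1 (hΓ h0)).2 i
      simp only at this
      rw [this]
  have hfac := factorial_le_card_typeClass_mul x₀
  have hcardΦ : Φ.card = (typeClass x₀).card * D := card_typeClassTriples x₀
  set A := (typeClass x₀).card
  set Q := ∏ i : Fin m, (Fintype.card {a // x₀ a = i})! with hQ
  set N := Fintype.card ι
  have hDm : D + (m - 1) ≤ D * m := by
    obtain ⟨k, rfl⟩ : ∃ k, m = k + 1 := ⟨m - 1, by omega⟩
    have : k ≤ D * k := Nat.le_mul_of_pos_left k hD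
    rw [Nat.add_sub_cancel, mul_add, mul_one]
    omega
  have hDm' : (D : ℝ) + ((m - 1 : ℕ) : ℝ) ≤ D * m := by exact_mod_cast hDm
  have hDle' : (D : ℝ) ≤ (m : ℝ) ^ (3 * N) := by exact_mod_cast hDle
  have hD0 : (0 : ℝ) < D := by exact_mod_cast hD
  set E := Real.exp (-4 * √(Real.log (12 * ((m : ℝ) ^ (3 * N) * m)))) with hE
  have hEle : E ≤ Real.exp (-4 * √(Real.log (12 * (D + ((m - 1 : ℕ) : ℝ))))) := by
    refine Real.exp_le_exp.2 ?_
    have h1 : (D : ℝ) + ((m - 1 : ℕ) : ℝ) ≤ (m : ℝ) ^ (3 * N) * m :=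
      hDm'.trans (mul_le_mul_of_nonneg_right hDle' (by positivity))
    have := Real.sqrt_le_sqrt (Real.log_le_log (x := 12 * (D + ((m - 1 : ℕ) : ℝ)))
      (by positivity) (mul_le_mul_of_nonneg_left h1 (by norm_num)))
    linarith
  have hAE : (A : ℝ) * E ≤ 48 * m * Γ.card := by
    refine le_of_mul_le_mul_left ?_ hD0
    calc (D : ℝ) * (A * E) = Φ.card * E := by rw [hcardΦ]; push_cast; ring
      _ ≤ Φ.card * Real.exp (-4 * √(Real.log (12 * (D + ((m - 1 : ℕ) : ℝ))))) := by gcongr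
      _ ≤ 48 * (D + ((m - 1 : ℕ) : ℝ)) * Γ.card := hcard
      _ ≤ 48 * (D * m) * Γ.card := by gcongr
      _ = _ := by ring
  have hfac' : ((N)! : ℝ) ≤ A * Q := by exact_mod_cast hfac
  have hΓle : (Γ.card : ℝ) ≤ maxTricolored (ι → ZMod m) := by exact_mod_cast hmax
  have hQc : ((Q : ℕ) : ℝ) = ∏ i : Fin m, ((Fintype.card {a // x₀ a = i})! : ℝ) := by
    rw [hQ]; push_cast; rfl
  rw [← hQc]
  calc ((N)! : ℝ) * E ≤ A * Q * E := by gcongr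
    _ = A * E * Q := by ring
    _ ≤ 48 * m * Γ.card * Q := by gcongr
    _ ≤ 48 * m * maxTricolored (ι → ZMod m) * Q := by gcongr

end TypeClass

/-! ### Words with prescribed frequencies -/

open Nat in
/-- Cyclically symmetric integer weights on the triples with sum `n` give a word to which
`factorial_le_maxTricolored` applies: the positions are the triples, with multiplicity, the letter
is the first entry, and the permutation rotates the triples. -/
theorem factorial_le_maxTricolored_of_weight {n : ℕ} (W : ℕ × ℕ × ℕ → ℕ)
    (hW : ∀ a b c, W (a, b, c) = W (b, c, a)) {L : ℕ} (hL : ∑ t ∈ triplesOfSum n, W t ≤ L) :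
    ((∑ t ∈ triplesOfSum n, W t)! : ℝ) *
        Real.exp (-4 * √(Real.log (12 * (((n + 1 : ℕ) : ℝ) ^
          (3 * ∑ t ∈ triplesOfSum n, W t) * (n + 1 : ℕ))))) ≤
      48 * (n + 1 : ℕ) * maxTricolored (Fin L → ZMod (n + 1)) *
        ∏ i ∈ Finset.range (n + 1),
          ((∑ t ∈ (triplesOfSum n).filter (fun t => t.1 = i), W t)! : ℝ) := by
  let ι := Σ t : triplesOfSum n, Fin (W t)
  have hcard : Fintype.card ι = ∑ t ∈ triplesOfSum n, W t := by
    simp only [ι, Fintype.card_sigma, Fintype.card_fin]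
    exact Finset.sum_coe_sort (triplesOfSum n) W
  let x₀ : ι → Fin (n + 1) := fun i => ⟨i.1.1.1, by
    have := mem_triplesOfSum.1 i.1.2; omega⟩
  let r : Equiv.Perm (triplesOfSum n) :=
    { toFun := fun t => ⟨(t.1.2.1, t.1.2.2, t.1.1), by
        have := mem_triplesOfSum.1 t.2; rw [mem_triplesOfSum]; simp only; omega⟩
      invFun := fun t => ⟨(t.1.2.2, t.1.1, t.1.2.1), by
        have := mem_triplesOfSum.1 t.2; rw [mem_triplesOfSum]; simp only; omega⟩
      left_inv := fun t => rfl
      right_inv := fun t => rfl }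
  let ρ : Equiv.Perm ι := Equiv.sigmaCongr r fun t => finCongr (hW t.1.1 t.1.2.1 t.1.2.2)
  have hρ : ∀ i, (x₀ i : ℕ) + x₀ (ρ i) + x₀ (ρ (ρ i)) = n + 1 - 1 := fun i =>
    mem_triplesOfSum.1 i.1.2
  have h := factorial_le_maxTricolored x₀ ρ hρ
  have hfib : ∀ i : Fin (n + 1), Fintype.card {a // x₀ a = i} =
      ∑ t ∈ (triplesOfSum n).filter (fun t => t.1 = (i : ℕ)), W t := by
    intro i
    rw [Fintype.card_subtype, Finset.card_filter, Fintype.sum_sigma, Finset.sum_filter]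
    refine Eq.trans (Finset.sum_congr rfl fun t _ => ?_)
      (Finset.sum_coe_sort (triplesOfSum n) fun t => if t.1 = (i : ℕ) then W t else 0)
    simp only [x₀, Fin.ext_iff, Finset.sum_const, Finset.card_univ, Fintype.card_fin, smul_eq_mul]
    split_ifs <;> simp
  rw [hcard] at h
  simp only [hfib] at h
  rw [Fin.prod_univ_eq_prod_range
    (fun i => ((∑ t ∈ (triplesOfSum n).filter (fun t => t.1 = i), W t)! : ℝ))] at h
  have hmono : maxTricolored (ι → ZMod (n + 1)) ≤ maxTricolored (Fin L → ZMod (n + 1)) := by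
    have e : Nonempty (ι ↪ Fin L) := Function.Embedding.nonempty_of_card_le (by
      rw [hcard, Fintype.card_fin]; exact hL)
    exact maxTricolored_pi_mono e.some
  refine h.trans ?_
  gcongr

/-! ### Asymptotics of the lower bound -/

open Nat in
lemma log_factorial_le (k : ℕ) :
    Real.log (k ! : ℝ) ≤ k * Real.log k - k + 1 + Real.log k / 2 := by
  rcases k with _ | k
  · simp
  have h := Stirling.log_stirlingSeq'_antitone (Nat.zero_le k)
  simp only [Function.comp_apply] at h
  rw [Stirling.log_stirlingSeq_formula, Nat.succ_eq_add_one, Nat.succ_eq_add_one, zero_add,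
    Stirling.stirlingSeq_one,
    Real.log_div (Real.exp_pos 1).ne' (by positivity), Real.log_exp, Real.log_sqrt (by norm_num),
    Real.log_mul (by norm_num) (by positivity), Real.log_div (by positivity) (Real.exp_pos 1).ne',
    Real.log_exp] at h
  linarith

open Nat in
lemma le_log_factorial (k : ℕ) : k * Real.log k - k ≤ Real.log (k ! : ℝ) := by
  rcases k.eq_zero_or_pos with rfl | hk
  · simp
  have h := Stirling.le_log_factorial_stirling hk.ne'
  have h1 : 0 ≤ Real.log k := Real.log_natCast_nonneg k
  have h2 : 0 ≤ Real.log (2 * Real.pi) :=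
    Real.log_nonneg (by have := Real.pi_gt_three; linarith)
  linarith

/-- The logarithm of a multinomial coefficient, rescaled, is an entropy up to lower order terms. -/
lemma le_log_factorial_sub_sum_log_factorial {ι : Type*} (s : Finset ι) (τ : ι → ℕ) {L : ℕ}
    (hL : 0 < L) (hτ : ∑ i ∈ s, τ i ≤ L) :
    L * (∑ i ∈ s, Real.negMulLog (τ i / L) - Real.negMulLog ((∑ i ∈ s, τ i : ℕ) / L))
        - s.card * (1 + Real.log L / 2) ≤
      Real.log (Nat.factorial (∑ i ∈ s, τ i) : ℝ)
        - ∑ i ∈ s, Real.log (Nat.factorial (τ i) : ℝ) := by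
  have hL0 : (L : ℝ) ≠ 0 := by positivity
  have hexp : ∀ k : ℕ, (k : ℝ) * Real.log k =
      -((k / L : ℝ) * Real.negMulLog L) - L * Real.negMulLog (k / L) := by
    intro k
    have h := Real.negMulLog_mul (L : ℝ) (k / L)
    rw [mul_div_cancel₀ _ hL0] at h
    have h' : Real.negMulLog (k : ℝ) = -((k : ℝ) * Real.log k) := by
      rw [Real.negMulLog, neg_mul]
    linarith
  have h1 := le_log_factorial (∑ i ∈ s, τ i)
  have h2 : ∑ i ∈ s, Real.log (Nat.factorial (τ i) : ℝ) ≤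
      ∑ i ∈ s, ((τ i : ℝ) * Real.log (τ i) - τ i + (1 + Real.log L / 2)) := by
    refine Finset.sum_le_sum fun i hi => ?_
    have h3 := log_factorial_le (τ i)
    have h4 : Real.log (τ i) ≤ Real.log L := by
      rcases (τ i).eq_zero_or_pos with h0 | h0
      · rw [h0]; simpa using Real.log_natCast_nonneg L
      · refine Real.log_le_log (by exact_mod_cast h0) ?_
        exact_mod_cast (Finset.single_le_sum (fun j _ => Nat.zero_le (τ j)) hi).trans hτ
    linarith
  rw [Finset.sum_add_distrib, Finset.sum_sub_distrib, Finset.sum_const, nsmul_eq_mul,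
    Finset.sum_congr rfl fun i _ => hexp (τ i), Finset.sum_sub_distrib, Finset.sum_neg_distrib,
    ← Finset.sum_mul, ← Finset.sum_div, ← Finset.mul_sum] at h2
  rw [hexp] at h1
  push_cast at h1 ⊢
  rw [mul_sub]
  linarith

lemma tendsto_log_natCast_div : Tendsto (fun L : ℕ => Real.log L / L) atTop (𝓝 0) :=
  Real.isLittleO_log_id_atTop.tendsto_div_nhds_zero.comp tendsto_natCast_atTop_atTop

lemma tendsto_sqrt_affine_div (A B : ℝ) :
    Tendsto (fun L : ℕ => √(A + B * L) / L) atTop (𝓝 0) := by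
  have h1 : Tendsto (fun L : ℕ => (L : ℝ)⁻¹) atTop (𝓝 0) := tendsto_inv_atTop_nhds_zero_nat
  have h2 : Tendsto (fun L : ℕ => √(A * (L : ℝ)⁻¹ ^ 2 + B * (L : ℝ)⁻¹)) atTop (𝓝 0) := by
    have := (((h1.pow 2).const_mul A).add (h1.const_mul B)).sqrt
    simpa using this
  refine h2.congr' ?_
  filter_upwards [eventually_gt_atTop 0] with L hL
  have hL' : (0 : ℝ) < L := by exact_mod_cast hL
  have e : A * (L : ℝ)⁻¹ ^ 2 + B * (L : ℝ)⁻¹ = (A + B * L) / (L : ℝ) ^ 2 := by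
    field_simp
  rw [e, Real.sqrt_div' _ (by positivity), Real.sqrt_sq hL'.le]

/-- The entropy of the truncated geometric distribution with ratio `x` and mean `n / 3`. -/
lemma sum_negMulLog_geometric {n : ℕ} {x : ℝ} (hx0 : 0 < x)
    (hx : ∑ i ∈ Finset.range (n + 1), (3 * (i : ℝ) - n) * x ^ i = 0) :
    ∑ i ∈ Finset.range (n + 1), Real.negMulLog (x ^ i / ∑ j ∈ Finset.range (n + 1), x ^ j)
      = Real.log (∑ j ∈ Finset.range (n + 1), x ^ j) - n / 3 * Real.log x := by
  set Z := ∑ j ∈ Finset.range (n + 1), x ^ j with hZdef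
  have hZ : 0 < Z := Finset.sum_pos (fun i _ => by positivity) ⟨0, by simp⟩
  have hmean : ∑ i ∈ Finset.range (n + 1), (i : ℝ) * x ^ i = n / 3 * Z := by
    simp only [sub_mul, Finset.sum_sub_distrib, mul_assoc, ← Finset.mul_sum] at hx
    linarith
  have : ∀ i : ℕ, Real.negMulLog (x ^ i / Z) =
      Real.log Z / Z * x ^ i - Real.log x / Z * (i * x ^ i) := by
    intro i
    rw [Real.negMulLog, Real.log_div (by positivity) hZ.ne', Real.log_pow]
    field_simp
    ring
  rw [Finset.sum_congr rfl fun i _ => this i, Finset.sum_sub_distrib, ← Finset.mul_sum,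
    ← Finset.mul_sum, hmean,
    ← hZdef]
  field_simp

lemma sum_fiber_triplesOfSum {M : Type*} [AddCommMonoid M] {n : ℕ} (f : ℕ × ℕ × ℕ → M) :
    ∑ i ∈ Finset.range (n + 1), ∑ t ∈ (triplesOfSum n).filter (fun t => t.1 = i), f t
      = ∑ t ∈ triplesOfSum n, f t :=
  Finset.sum_fiberwise_of_maps_to (fun t ht => Finset.mem_range.2 (by
    have := mem_triplesOfSum.1 ht; omega)) f

/-- The exponential growth rate of tricolored sum-free sets in `(ZMod (n + 1)) ^ L` is at least
the entropy of the truncated geometric distribution with mean `n / 3`. -/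
theorem exists_lower_rate {n : ℕ} (hn : 0 < n) {x : ℝ} (hx0 : 0 < x) (hx1 : x ≤ 1)
    (hx : ∑ i ∈ Finset.range (n + 1), (3 * (i : ℝ) - n) * x ^ i = 0) :
    ∃ a : ℕ → ℝ, Tendsto a atTop
        (𝓝 (Real.log (∑ j ∈ Finset.range (n + 1), x ^ j) - n / 3 * Real.log x)) ∧
      ∀ L : ℕ, 0 < L → Real.exp (L * a L) ≤ maxTricolored (Fin L → ZMod (n + 1)) := by
  obtain ⟨w, hw0, hwc, hw⟩ := exists_cyclic_weight hn hx0.le hx1 hx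
  set Z := ∑ j ∈ Finset.range (n + 1), x ^ j with hZdef
  have hZ : 0 < Z := Finset.sum_pos (fun i _ => by positivity) ⟨0, by simp⟩
  have hwZ : ∑ t ∈ triplesOfSum n, w t = Z := by
    rw [← sum_fiber_triplesOfSum]
    exact Finset.sum_congr rfl fun i hi => hw i (Nat.lt_succ_iff.1 (Finset.mem_range.1 hi))
  let W : ℕ → ℕ × ℕ × ℕ → ℕ := fun L t => ⌊w t / Z * L⌋₊
  let τ : ℕ → ℕ → ℕ := fun L i => ∑ t ∈ (triplesOfSum n).filter (fun t => t.1 = i), W L t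
  have hτsum : ∀ L, ∑ i ∈ Finset.range (n + 1), τ L i = ∑ t ∈ triplesOfSum n, W L t :=
    fun L => sum_fiber_triplesOfSum (W L)
  have hWL : ∀ L, ∑ t ∈ triplesOfSum n, W L t ≤ L := by
    intro L
    have : ((∑ t ∈ triplesOfSum n, W L t : ℕ) : ℝ) ≤ L := by
      push_cast
      calc ∑ t ∈ triplesOfSum n, (W L t : ℝ) ≤ ∑ t ∈ triplesOfSum n, w t / Z * L :=
            Finset.sum_le_sum fun t _ => Nat.floor_le
              (mul_nonneg (div_nonneg (hw0 t) hZ.le) (Nat.cast_nonneg L))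
        _ = L := by
            rw [← Finset.sum_mul, ← Finset.sum_div, hwZ, div_self hZ.ne', one_mul]
    exact_mod_cast this
  have hWlim : ∀ t, Tendsto (fun L : ℕ => (W L t : ℝ) / L) atTop (𝓝 (w t / Z)) := fun t =>
    (tendsto_nat_floor_mul_div_atTop (div_nonneg (hw0 t) hZ.le)).comp tendsto_natCast_atTop_atTop
  have hτlim : ∀ i ≤ n, Tendsto (fun L : ℕ => (τ L i : ℝ) / L) atTop (𝓝 (x ^ i / Z)) := by
    intro i hi
    rw [← hw i hi, Finset.sum_div]
    refine (tendsto_finsetSum _ fun t _ => hWlim t).congr fun L => ?_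
    simp only [τ]
    push_cast
    rw [Finset.sum_div]
  have hNlim : Tendsto (fun L : ℕ => ((∑ i ∈ Finset.range (n + 1), τ L i : ℕ) : ℝ) / L) atTop
      (𝓝 1) := by
    have h1 : ∑ i ∈ Finset.range (n + 1), x ^ i / Z = 1 := by
      rw [← Finset.sum_div, ← hZdef, div_self hZ.ne']
    rw [← h1]
    refine (tendsto_finsetSum (Finset.range (n + 1)) fun i hi =>
      hτlim i (Nat.lt_succ_iff.1 (Finset.mem_range.1 hi))).congr fun L => ?_
    push_cast
    rw [Finset.sum_div]
  set m : ℝ := ((n + 1 : ℕ) : ℝ) with hm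
  have hm1 : 1 ≤ m := by rw [hm]; exact_mod_cast Nat.le_add_left 1 n
  let err : ℕ → ℝ := fun L => m * (1 + Real.log L / 2) +
    4 * √((Real.log 12 + Real.log m) + 3 * Real.log m * L) + Real.log (48 * m)
  have herr : Tendsto (fun L : ℕ => err L / L) atTop (𝓝 0) := by
    have h1 := tendsto_log_natCast_div.const_mul (m / 2)
    have h2 := (tendsto_sqrt_affine_div (Real.log 12 + Real.log m) (3 * Real.log m)).const_mul 4
    have h3 := (tendsto_inv_atTop_nhds_zero_nat (𝕜 := ℝ)).const_mul (m + Real.log (48 * m))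
    have h4 := (h1.add h2).add h3
    simp only [mul_zero, add_zero] at h4
    refine h4.congr fun L => ?_
    simp only [err]
    ring
  refine ⟨fun L => (∑ i ∈ Finset.range (n + 1), Real.negMulLog (τ L i / L)
    - Real.negMulLog ((∑ i ∈ Finset.range (n + 1), τ L i : ℕ) / L)) - err L / L, ?_, ?_⟩
  · rw [← sum_negMulLog_geometric hx0 hx]
    have h1 : Tendsto (fun L : ℕ => ∑ i ∈ Finset.range (n + 1), Real.negMulLog (τ L i / L)) atTop
        (𝓝 (∑ i ∈ Finset.range (n + 1), Real.negMulLog (x ^ i / Z))) :=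
      tendsto_finsetSum _ fun i hi => (Real.continuous_negMulLog.tendsto _).comp
        (hτlim i (Nat.lt_succ_iff.1 (Finset.mem_range.1 hi)))
    have h2 := (Real.continuous_negMulLog.tendsto 1).comp hNlim
    have h3 := (h1.sub h2).sub herr
    simpa only [Real.negMulLog_one, sub_zero] using! h3
  · intro L hL
    have hL' : (0 : ℝ) < L := by exact_mod_cast hL
    have hmain := factorial_le_maxTricolored_of_weight (n := n) (W L)
      (fun a b c => by simp only [W]; rw [hwc a b c]) (hWL L)
    set s := maxTricolored (Fin L → ZMod (n + 1)) with hs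
    have hspos : 0 < s := by
      rcases s.eq_zero_or_pos with h0 | h0
      · rw [h0] at hmain
        simp only [Nat.cast_zero, mul_zero, zero_mul] at hmain
        exact absurd hmain (not_le.2 (by positivity))
      · exact h0
    have hs' : (0 : ℝ) < s := by exact_mod_cast hspos
    have hent := le_log_factorial_sub_sum_log_factorial (Finset.range (n + 1)) (τ L) hL
      (by rw [hτsum]; exact hWL L)
    have hlog := Real.log_le_log (by positivity) hmain
    rw [Real.log_mul (by positivity) (Real.exp_pos _).ne', Real.log_exp,
      Real.log_mul (x := 48 * m * s) (by positivity) (by positivity),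
      Real.log_mul (x := 48 * m) (by positivity) hs'.ne',
      Real.log_prod (fun i _ => by positivity), ← hτsum L] at hlog
    have hsq : √(Real.log (12 * (m ^ (3 * ∑ i ∈ Finset.range (n + 1), τ L i) * m))) ≤
        √((Real.log 12 + Real.log m) + 3 * Real.log m * L) := by
      refine Real.sqrt_le_sqrt ?_
      rw [Real.log_mul (by norm_num) (by positivity), Real.log_mul (by positivity) (by positivity),
        Real.log_pow, hτsum L]
      have h1 : ((3 * ∑ t ∈ triplesOfSum n, W L t : ℕ) : ℝ) ≤ 3 * L := by
        exact_mod_cast Nat.mul_le_mul_left 3 (hWL L)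
      have h2 := mul_le_mul_of_nonneg_right h1 (Real.log_nonneg hm1)
      linarith
    rw [← Real.exp_log hs', Real.exp_le_exp, mul_sub, mul_div_cancel₀ _ hL'.ne']
    rw [Finset.card_range] at hent
    simp only [err]
    linarith

/-! ### Binomial coefficients modulo `p` -/

/-- Binomial coefficients `choose u j` modulo `p` with `j < p ^ k` are periodic in `u` with period
`p ^ k`, as `(1 + X) ^ (p ^ k) = 1 + X ^ (p ^ k)`. -/
lemma cast_choose_mul_add {p k : ℕ} [Fact p.Prime] (q s : ℕ) {j : ℕ} (hj : j < p ^ k) :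
    ((Nat.choose (p ^ k * q + s) j : ℕ) : ZMod p) = Nat.choose s j := by
  have hpow : ∃ h : (ZMod p)[X],
      (1 + Polynomial.X) ^ (p ^ k * q) = 1 + Polynomial.X ^ (p ^ k) * h := by
    rw [pow_mul, add_pow_char_pow, one_pow]
    induction q with
    | zero => exact ⟨0, by simp⟩
    | succ q ih =>
      obtain ⟨h, hh⟩ := ih
      exact ⟨1 + h + Polynomial.X ^ (p ^ k) * h, by rw [pow_succ, hh]; ring⟩
  obtain ⟨h, hh⟩ := hpow
  rw [← Polynomial.coeff_one_add_X_pow, ← Polynomial.coeff_one_add_X_pow, pow_add, hh, add_mul,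
    one_mul, Polynomial.coeff_add, mul_assoc, Polynomial.coeff_X_pow_mul', if_neg (by omega),
    add_zero]

lemma cast_choose_eq_ite {p k : ℕ} [Fact p.Prime] (u : ℕ) :
    ((Nat.choose (u + (p ^ k - 1)) (p ^ k - 1) : ℕ) : ZMod p) = if p ^ k ∣ u then 1 else 0 := by
  have hm : 0 < p ^ k := pow_pos (Fact.out : p.Prime).pos k
  have hdiv := Nat.div_add_mod u (p ^ k)
  have hlt := Nat.mod_lt u hm
  rcases Nat.eq_zero_or_pos (u % p ^ k) with h0 | h0
  · rw [if_pos (Nat.dvd_of_mod_eq_zero h0), ← hdiv, h0, add_zero, cast_choose_mul_add _ _ (by omega),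
      Nat.choose_self, Nat.cast_one]
  · rw [if_neg (fun h => h0.ne' (Nat.mod_eq_zero_of_dvd h))]
    have e : u + (p ^ k - 1) = p ^ k * (u / p ^ k + 1) + (u % p ^ k - 1) := by
      rw [mul_add, mul_one]; omega
    rw [e, cast_choose_mul_add _ _ (by omega), Nat.choose_eq_zero_of_lt (by omega), Nat.cast_zero]

lemma choose_add_add_eq_sum {m : ℕ} [NeZero m] (u v w : ℕ) :
    Nat.choose (u + v + w) (m - 1) =
      ∑ t : Fin m × Fin m × Fin m with (t.1 : ℕ) + t.2.1 + t.2.2 = m - 1,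
        Nat.choose u t.1 * Nat.choose v t.2.1 * Nat.choose w t.2.2 := by
  have hm : 0 < m := Nat.pos_of_ne_zero (NeZero.ne m)
  rw [Nat.add_choose_eq]
  simp only [Nat.add_choose_eq u v, Finset.sum_mul]
  rw [Finset.sum_sigma']
  symm
  refine Finset.sum_nbij (fun t => ⟨((t.1 : ℕ) + t.2.1, (t.2.2 : ℕ)), ((t.1 : ℕ), (t.2.1 : ℕ))⟩)
    ?_ ?_ ?_ ?_
  · intro t ht
    simpa using ht
  · rintro ⟨a, b, c⟩ _ ⟨a', b', c'⟩ _ h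
    simp only [Sigma.mk.injEq, Prod.mk.injEq, heq_eq_eq] at h
    exact Prod.ext (Fin.ext h.2.1) (Prod.ext (Fin.ext h.2.2) (Fin.ext h.1.2))
  · rintro ⟨⟨e, c⟩, ⟨a, b⟩⟩ h
    obtain ⟨h1, h2⟩ := Finset.mem_sigma.1 (Finset.mem_coe.1 h)
    rw [Finset.HasAntidiagonal.mem_antidiagonal] at h1 h2
    simp only at h1 h2
    subst h2
    refine ⟨(⟨a, by omega⟩, ⟨b, by omega⟩, ⟨c, by omega⟩), ?_, rfl⟩
    simpa using h1
  · intro t _; rfl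

section BinomialBasis

variable (p k : ℕ) [Fact p.Prime]

/-- The function `x ↦ choose x a` on `ZMod (p ^ k)`, with values modulo `p`. -/
def binomFun (a : Fin (p ^ k)) : ZMod (p ^ k) → ZMod p := fun x => (Nat.choose x.val a : ℕ)

/-- The function `x ↦ choose (x + p ^ k - 1) a` on `ZMod (p ^ k)`, with values modulo `p`. -/
def shiftedBinomFun (a : Fin (p ^ k)) : ZMod (p ^ k) → ZMod p :=
  fun x => (Nat.choose (x.val + (p ^ k - 1)) a : ℕ)

/-- The indicator function of `x + y + z = 0` in the binomial functions: the Vandermonde identity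
for `choose (x + y + z + p ^ k - 1) (p ^ k - 1)`, read modulo `p`. -/
theorem sum_binomFun_eq_ite (x y z : ZMod (p ^ k)) :
    ∑ t : Fin (p ^ k) × Fin (p ^ k) × Fin (p ^ k) with (t.1 : ℕ) + t.2.1 + t.2.2 = p ^ k - 1,
      binomFun p k t.1 x * binomFun p k t.2.1 y * shiftedBinomFun p k t.2.2 z
      = if x + y + z = 0 then 1 else 0 := by
  have h := choose_add_add_eq_sum (m := p ^ k) x.val y.val (z.val + (p ^ k - 1))
  rw [← add_assoc] at h
  have h' := cast_choose_eq_ite (p := p) (k := k) (x.val + y.val + z.val)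
  rw [h] at h'
  have hz : (p ^ k ∣ x.val + y.val + z.val) ↔ x + y + z = 0 := by
    rw [← ZMod.natCast_eq_zero_iff]
    simp only [Nat.cast_add, ZMod.natCast_zmod_val]
  simp only [hz] at h'
  rw [← h']
  push_cast
  rfl

lemma sum_binomFun_mul_eq_ite (x z : ZMod (p ^ k)) :
    ∑ a, binomFun p k a x * shiftedBinomFun p k a.rev z = if x + z = 0 then 1 else 0 := by
  have h' := cast_choose_eq_ite (p := p) (k := k) (x.val + z.val)
  have hm : 0 < p ^ k := pow_pos (Fact.out : p.Prime).pos k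
  have hz : (p ^ k ∣ x.val + z.val) ↔ x + z = 0 := by
    rw [← ZMod.natCast_eq_zero_iff]
    simp only [Nat.cast_add, ZMod.natCast_zmod_val]
  rw [add_assoc, Nat.add_choose_eq, Finset.Nat.sum_antidiagonal_eq_sum_range_succ_mk] at h'
  simp only [hz] at h'
  rw [← h', Nat.succ_eq_add_one, Nat.sub_add_cancel hm, ← Fin.sum_univ_eq_sum_range
    (fun a => x.val.choose a * (z.val + (p ^ k - 1)).choose (p ^ k - 1 - a))]
  push_cast
  refine Finset.sum_congr rfl fun a _ => ?_
  rw [binomFun, shiftedBinomFun, Fin.val_rev, Nat.sub_add_eq, Nat.sub_right_comm]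

lemma span_binomFun : ⊤ ≤ Submodule.span (ZMod p) (Set.range (binomFun p k)) := by
  intro g _
  have : g = ∑ a, (∑ z, g (-z) * shiftedBinomFun p k a.rev z) • binomFun p k a := by
    funext x
    simp only [Finset.sum_apply, Pi.smul_apply, smul_eq_mul, Finset.sum_mul]
    rw [Finset.sum_comm]
    calc g x = ∑ z, g (-z) * (if x + z = 0 then 1 else 0) := by
          rw [Finset.sum_eq_single (-x)]
          · simp
          · intro z _ hz
            rw [if_neg (fun h => hz (eq_neg_of_add_eq_zero_right h)), mul_zero]
          · simp
      _ = _ := by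
          refine Finset.sum_congr rfl fun z _ => ?_
          rw [← sum_binomFun_mul_eq_ite, Finset.mul_sum]
          exact Finset.sum_congr rfl fun a _ => by ring
  rw [this]
  exact Submodule.sum_mem _ fun a _ => Submodule.smul_mem _ _ (Submodule.subset_span ⟨a, rfl⟩)

lemma span_shiftedBinomFun : ⊤ ≤ Submodule.span (ZMod p) (Set.range (shiftedBinomFun p k)) := by
  intro g _
  have : g = ∑ a : Fin (p ^ k), (∑ x, g (-x) * binomFun p k a x) • shiftedBinomFun p k a.rev := by
    funext z
    simp only [Finset.sum_apply, Pi.smul_apply, smul_eq_mul, Finset.sum_mul]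
    rw [Finset.sum_comm]
    calc g z = ∑ x, g (-x) * (if x + z = 0 then 1 else 0) := by
          rw [Finset.sum_eq_single (-z)]
          · simp
          · intro x _ hx
            rw [if_neg (fun h => hx (eq_neg_of_add_eq_zero_left h)), mul_zero]
          · simp
      _ = _ := by
          refine Finset.sum_congr rfl fun x _ => ?_
          rw [← sum_binomFun_mul_eq_ite, Finset.mul_sum]
          exact Finset.sum_congr rfl fun a _ => by ring
  rw [this]
  exact Submodule.sum_mem _ fun a _ => Submodule.smul_mem _ _ (Submodule.subset_span ⟨_, rfl⟩)

/-- The basis of the functions on `ZMod (p ^ k)` formed by the functions `binomFun`. -/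
noncomputable def binomBasis : Module.Basis (Fin (p ^ k)) (ZMod p) (ZMod (p ^ k) → ZMod p) :=
  basisOfTopLeSpanOfCardEqFinrank (binomFun p k) (span_binomFun p k) (by simp)

/-- The basis of the functions on `ZMod (p ^ k)` formed by the functions `shiftedBinomFun`. -/
noncomputable def shiftedBinomBasis :
    Module.Basis (Fin (p ^ k)) (ZMod p) (ZMod (p ^ k) → ZMod p) :=
  basisOfTopLeSpanOfCardEqFinrank (shiftedBinomFun p k) (span_shiftedBinomFun p k) (by simp)

lemma binomBasis_apply (a : Fin (p ^ k)) : binomBasis p k a = binomFun p k a := by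
  simp [binomBasis]

lemma shiftedBinomBasis_apply (a : Fin (p ^ k)) :
    shiftedBinomBasis p k a = shiftedBinomFun p k a := by
  simp [shiftedBinomBasis]

/-! ### The cap set tensor as a structure tensor -/

lemma sum_smul_tmul_sum_smul {F V W ι κ : Type*} [Field F] [AddCommGroup V] [Module F V]
    [AddCommGroup W] [Module F W] [Fintype ι] [Fintype κ] (f : ι → F) (u : ι → V) (g : κ → F)
    (v : κ → W) : (∑ i, f i • u i) ⊗ₜ[F] (∑ j, g j • v j) =
      ∑ i, ∑ j, (f i * g j) • (u i ⊗ₜ[F] v j) := by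
  rw [TensorProduct.sum_tmul]
  refine Finset.sum_congr rfl fun i _ => ?_
  rw [TensorProduct.tmul_sum]
  exact Finset.sum_congr rfl fun j _ => TensorProduct.smul_tmul_smul _ _ _ _

lemma capSetTensor_eq_sum_binomFun :
    capSetTensor (ZMod p) (p ^ k) =
      ∑ t : Fin (p ^ k) × Fin (p ^ k) × Fin (p ^ k) with (t.1 : ℕ) + t.2.1 + t.2.2 = p ^ k - 1,
        binomFun p k t.1 ⊗ₜ[ZMod p] (binomFun p k t.2.1 ⊗ₜ[ZMod p] shiftedBinomFun p k t.2.2) := by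
  have hexp : ∀ f g h : ZMod (p ^ k) → ZMod p, f ⊗ₜ[ZMod p] (g ⊗ₜ[ZMod p] h) =
      ∑ α : ZMod (p ^ k) × ZMod (p ^ k) × ZMod (p ^ k), (f α.1 * g α.2.1 * h α.2.2) •
        (Pi.single α.1 (1 : ZMod p) ⊗ₜ[ZMod p] (Pi.single α.2.1 (1 : ZMod p) ⊗ₜ[ZMod p]
          Pi.single α.2.2 (1 : ZMod p))) := by
    intro f g h
    have hs : ∀ f : ZMod (p ^ k) → ZMod p, f = ∑ x, f x • Pi.single x (1 : ZMod p) := fun f => by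
      simpa using (pi_eq_sum_univ' f)
    conv_lhs => rw [hs f, hs g, hs h]
    simp only [Fintype.sum_prod_type, mul_assoc]
    rw [TensorProduct.sum_tmul]
    refine Finset.sum_congr rfl fun x _ => ?_
    rw [sum_smul_tmul_sum_smul, TensorProduct.tmul_sum]
    refine Finset.sum_congr rfl fun y _ => ?_
    rw [TensorProduct.tmul_sum]
    refine Finset.sum_congr rfl fun z _ => ?_
    rw [TensorProduct.smul_tmul_smul]
  rw [Finset.sum_congr rfl fun t _ => hexp _ _ _, capSetTensor, Finset.sum_comm,
    Finset.sum_filter]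
  refine Finset.sum_congr rfl fun α _ => ?_
  rw [← Finset.sum_smul, sum_binomFun_eq_ite]
  split_ifs <;> simp

end BinomialBasis

lemma structureTensor_eq_sum {F A ι : Type*} [Field F] [Ring A] [Algebra F A] [Fintype ι]
    (b : Module.Basis ι F A) :
    structureTensor b = ∑ i, ∑ j, b i ⊗ₜ[F] (b j ⊗ₜ[F] (b i * b j)) := by
  refine Finset.sum_congr rfl fun i _ => Finset.sum_congr rfl fun j _ => ?_
  conv_rhs => rw [← b.sum_repr (b i * b j)]
  simp only [TensorProduct.tmul_sum, TensorProduct.tmul_smul, Module.Basis.coord_apply]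

/-- The structure tensor in another basis `c`: the first two factors carry the dual basis of `c`,
identified with vectors through the basis `b`. -/
lemma structureTensor_eq_sum_dual {F A ι : Type*} [Field F] [Ring A] [Algebra F A] [Fintype ι]
    [DecidableEq ι] (b c : Module.Basis ι F A) :
    structureTensor b = ∑ i, ∑ j, b.toDualEquiv.symm (c.dualBasis i) ⊗ₜ[F]
      (b.toDualEquiv.symm (c.dualBasis j) ⊗ₜ[F] (c i * c j)) := by
  have hθ : ∀ a, b.toDualEquiv.symm (c.dualBasis a) = ∑ i, c.repr (b i) a • b i := by
    intro a
    rw [LinearEquiv.symm_apply_eq]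
    refine b.ext fun j => ?_
    simp [Module.Basis.toDual_apply]
  have hb : ∀ i, b i = ∑ a, c.repr (b i) a • c a := fun i => (c.sum_repr (b i)).symm
  have hmul : ∀ i j, b i * b j =
      ∑ x, ∑ y, (c.repr (b i) x * c.repr (b j) y) • (c x * c y) := by
    intro i j
    conv_lhs => rw [hb i, hb j]
    simp only [Finset.sum_mul_sum, smul_mul_smul_comm]
  have hl : ∀ i j, b i ⊗ₜ[F] (b j ⊗ₜ[F] (b i * b j)) = ∑ x, ∑ y,
      (c.repr (b i) x * c.repr (b j) y) • (b i ⊗ₜ[F] (b j ⊗ₜ[F] (c x * c y))) := by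
    intro i j
    rw [hmul i j]
    simp only [TensorProduct.tmul_sum, TensorProduct.tmul_smul]
  have hr : ∀ x y, (∑ i, c.repr (b i) x • b i) ⊗ₜ[F]
      ((∑ j, c.repr (b j) y • b j) ⊗ₜ[F] (c x * c y)) = ∑ i, ∑ j,
      (c.repr (b i) x * c.repr (b j) y) • (b i ⊗ₜ[F] (b j ⊗ₜ[F] (c x * c y))) := by
    intro x y
    rw [← sum_smul_tmul_sum_smul, TensorProduct.sum_tmul (s := Finset.univ)
      (m := fun j => c.repr (b j) y • b j)]
    simp only [TensorProduct.smul_tmul']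
  rw [structureTensor_eq_sum]
  simp only [hθ, hl, hr]
  calc _ = ∑ i, ∑ x, ∑ j, ∑ y,
        (c.repr (b i) x * c.repr (b j) y) • (b i ⊗ₜ[F] (b j ⊗ₜ[F] (c x * c y))) :=
        Finset.sum_congr rfl fun i _ => Finset.sum_comm
    _ = ∑ x, ∑ i, ∑ y, ∑ j,
        (c.repr (b i) x * c.repr (b j) y) • (b i ⊗ₜ[F] (b j ⊗ₜ[F] (c x * c y))) := by
        rw [Finset.sum_comm]
        exact Finset.sum_congr rfl fun x _ => Finset.sum_congr rfl fun i _ => Finset.sum_comm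
    _ = _ := Finset.sum_congr rfl fun x _ => Finset.sum_comm

/-- The cap set tensor is the structure tensor of any algebra with a basis `c₀, …, c_{m-1}`,
`m = p ^ k`, in which `c_i c_j = c_{i+j}`, or `0` if `i + j ≥ m`. -/
theorem tensorIsomorphic_capSetTensor_of_basis {p k : ℕ} [Fact p.Prime] {A : Type*} [Ring A]
    [Algebra (ZMod p) A] (b c : Module.Basis (Fin (p ^ k)) (ZMod p) A)
    (hc : ∀ i j : Fin (p ^ k), c i * c j =
      ∑ l : Fin (p ^ k), if (i : ℕ) + j + l = p ^ k - 1 then c l.rev else 0) :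
    TensorIsomorphic (capSetTensor (ZMod p) (p ^ k)) (structureTensor b) := by
  let e₁ := ((binomBasis p k).equiv c.dualBasis (Equiv.refl _)).trans b.toDualEquiv.symm
  let e₃ := (shiftedBinomBasis p k).equiv c Fin.revPerm
  have he₁ : ∀ a, e₁ (binomFun p k a) = b.toDualEquiv.symm (c.dualBasis a) := by
    intro a
    rw [← binomBasis_apply]
    simp [e₁]
  have he₃ : ∀ a, e₃ (shiftedBinomFun p k a) = c a.rev := by
    intro a
    rw [← shiftedBinomBasis_apply]
    simp [e₃]
  refine ⟨e₁, e₁, e₃, ?_⟩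
  rw [capSetTensor_eq_sum_binomFun, structureTensor_eq_sum_dual b c, map_sum, Finset.sum_filter,
    Fintype.sum_prod_type]
  refine Finset.sum_congr rfl fun i _ => ?_
  rw [Fintype.sum_prod_type]
  refine Finset.sum_congr rfl fun j _ => ?_
  rw [hc, TensorProduct.tmul_sum, TensorProduct.tmul_sum]
  refine Finset.sum_congr rfl fun l _ => ?_
  simp only [TensorProduct.congr_tmul, he₁, he₃]
  split_ifs <;> simp

theorem tensorIsomorphic_capSetTensor (p k : ℕ) [Fact p.Prime]
    (b : Module.Basis (Fin (p ^ k)) (ZMod p)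
      (AdjoinRoot (Polynomial.X ^ (p ^ k) : (ZMod p)[X]))) :
    TensorIsomorphic (capSetTensor (ZMod p) (p ^ k)) (structureTensor b) := by
  let f : (ZMod p)[X] := Polynomial.X ^ (p ^ k)
  have hmonic : f.Monic := Polynomial.monic_X_pow (p ^ k)
  let c : Module.Basis (Fin (p ^ k)) (ZMod p) (AdjoinRoot f) :=
    (AdjoinRoot.powerBasis' hmonic).basis.reindex
      (finCongr (by rw [AdjoinRoot.powerBasis'_dim, Polynomial.natDegree_X_pow]))
  have hc : ∀ a, c a = AdjoinRoot.root f ^ (a : ℕ) := by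
    intro a
    simp [c]
  have hroot : AdjoinRoot.root f ^ (p ^ k) = 0 := by
    have := AdjoinRoot.eval₂_root f
    rwa [Polynomial.eval₂_X_pow] at this
  refine tensorIsomorphic_capSetTensor_of_basis b c fun a b => ?_
  rw [hc, hc, ← pow_add]
  by_cases h : (a : ℕ) + b < p ^ k
  · rw [Finset.sum_eq_single (⟨(a : ℕ) + b, h⟩ : Fin (p ^ k)).rev]
    · rw [if_pos, Fin.rev_rev, hc]
      rw [Fin.val_rev]; simp only; omega
    · intro e _ he
      rw [if_neg]
      intro h'
      apply he
      ext
      rw [Fin.val_rev]; simp only; omega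
    · simp
  · rw [Finset.sum_eq_zero fun e _ => if_neg (by omega)]
    exact pow_eq_zero_of_le (by omega) hroot

/-! ### The slice rank bound -/

/-- A subspace of `F ^ I` of dimension `d` contains a vector with at least `d` nonzero entries. -/
lemma exists_card_support_ge_finrank {F I : Type*} [Field F] [DecidableEq F] [Fintype I]
    [DecidableEq I] (V : Submodule F (I → F)) :
    ∃ h ∈ V, Module.finrank F V ≤ (Finset.univ.filter fun i => h i ≠ 0).card := by
  let P : ℕ → Prop := fun n => ∃ h ∈ V, (Finset.univ.filter fun i => h i ≠ 0).card = n
  have hP : ∃ n, P n := ⟨_, 0, V.zero_mem, rfl⟩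
  have hbd : ∀ n, P n → n ≤ Fintype.card I := by
    rintro _ ⟨h, -, rfl⟩; exact Finset.card_le_univ _
  classical
  obtain ⟨n, hn⟩ := hP
  have hspec := Nat.findGreatest_spec (hbd n hn) hn
  obtain ⟨h, hV, hcard⟩ := hspec
  refine ⟨h, hV, ?_⟩
  -- If the maximal support is too small, a vector vanishing on it can be added.
  by_contra! hlt
  set s := Finset.univ.filter fun i => h i ≠ 0 with hs
  let r : V →ₗ[F] (s → F) := LinearMap.pi fun i => (LinearMap.proj i.1).comp V.subtype
  have hker : LinearMap.ker r ≠ ⊥ := LinearMap.ker_ne_bot_of_finrank_lt (by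
    rw [Module.finrank_fintype_fun_eq_card, Fintype.card_coe]; exact hlt)
  obtain ⟨g, hg, hg0⟩ := (Submodule.ne_bot_iff _).1 hker
  have hgs : ∀ i ∈ s, g.1 i = 0 := fun i hi =>
    congrFun (LinearMap.mem_ker.1 hg) ⟨i, hi⟩
  obtain ⟨j, hj⟩ := Function.ne_iff.1 (fun e => hg0 (Subtype.ext e) : g.1 ≠ 0)
  have hjs : j ∉ s := fun h' => hj (hgs j h')
  have hsub : insert j s ⊆ Finset.univ.filter fun i => (h + g.1) i ≠ 0 := by
    intro i hi
    rw [Finset.mem_filter]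
    refine ⟨Finset.mem_univ i, ?_⟩
    rcases Finset.mem_insert.1 hi with rfl | hi
    · have : h i = 0 := by simpa [hs] using hjs
      simpa [this] using hj
    · simpa [hgs i hi, hs] using hi
  have h1 := Finset.card_le_card hsub
  rw [Finset.card_insert_of_notMem hjs] at h1
  have h2 : P (Finset.univ.filter fun i => (h + g.1) i ≠ 0).card :=
    ⟨h + g.1, V.add_mem hV g.2, rfl⟩
  have h3 := Nat.le_findGreatest (hbd _ h2) h2
  omega

/-- The slice rank of a diagonal tensor is its size. -/
theorem card_le_of_slice_decomposition {F I κ : Type*} [Field F] [Fintype I] [DecidableEq I]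
    (S₁ S₂ S₃ : Finset κ) (u₁ u₂ u₃ : κ → I → F) (f₁ f₂ f₃ : κ → I → I → F)
    (h : ∀ i j k, (if i = j ∧ j = k then (1 : F) else 0) =
      ∑ a ∈ S₁, u₁ a i * f₁ a j k + ∑ a ∈ S₂, u₂ a j * f₂ a i k + ∑ a ∈ S₃, u₃ a k * f₃ a i j) :
    Fintype.card I ≤ S₁.card + S₂.card + S₃.card := by
  classical
  -- A vector orthogonal to the first family reduces the tensor to a matrix.
  let r : (I → F) →ₗ[F] (S₁ → F) := LinearMap.pi fun a => ∑ i, u₁ a.1 i • LinearMap.proj i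
  obtain ⟨g, hg, hcard⟩ := exists_card_support_ge_finrank (LinearMap.ker r)
  have hker : Fintype.card I ≤ S₁.card + Module.finrank F (LinearMap.ker r) := by
    have h1 := LinearMap.finrank_range_add_finrank_ker r
    have h2 := Submodule.finrank_le (LinearMap.range r)
    rw [Module.finrank_fintype_fun_eq_card] at h1 h2
    rw [Fintype.card_coe] at h2
    omega
  have horth : ∀ a ∈ S₁, ∑ i, u₁ a i * g i = 0 := by
    intro a ha
    have := congrFun (LinearMap.mem_ker.1 hg) ⟨a, ha⟩
    simpa [r] using this
  let A : Matrix I (S₂ ⊕ S₃) F := Matrix.of fun j => Sum.elim (fun a => u₂ a.1 j)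
    fun a => ∑ i, g i * f₃ a.1 i j
  let B : Matrix (S₂ ⊕ S₃) I F := Matrix.of (Sum.elim (fun a k => ∑ i, g i * f₂ a.1 i k)
    fun a k => u₃ a.1 k)
  have hAB : Matrix.diagonal g = A * B := by
    ext j k
    have e1 : Matrix.diagonal g j k = ∑ i, g i * (if i = j ∧ j = k then (1 : F) else 0) := by
      rw [Finset.sum_eq_single j]
      · by_cases hjk : j = k
        · subst hjk; simp
        · simp [hjk]
      · intro i _ hi; simp [hi]
      · simp
    rw [e1, Matrix.mul_apply, Fintype.sum_sum_type]
    simp only [A, B, Matrix.of_apply, Sum.elim_inl, Sum.elim_inr]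
    rw [Finset.sum_coe_sort S₂ fun a => u₂ a j * ∑ i, g i * f₂ a i k,
      Finset.sum_coe_sort S₃ fun a => (∑ i, g i * f₃ a i j) * u₃ a k]
    simp only [h, mul_add, Finset.sum_add_distrib, Finset.mul_sum, Finset.sum_mul]
    rw [Finset.sum_comm (t := S₁), Finset.sum_comm (t := S₂), Finset.sum_comm (t := S₃)]
    have e2 : ∑ a ∈ S₁, ∑ i, g i * (u₁ a i * f₁ a j k) = 0 := by
      refine Finset.sum_eq_zero fun a ha => ?_
      have : ∀ i, g i * (u₁ a i * f₁ a j k) = u₁ a i * g i * f₁ a j k := fun i => by ring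
      rw [Finset.sum_congr rfl fun i _ => this i, ← Finset.sum_mul, horth a ha, zero_mul]
    rw [e2, zero_add]
    congr 1
    · exact Finset.sum_congr rfl fun a _ => Finset.sum_congr rfl fun i _ => by ring
    · exact Finset.sum_congr rfl fun a _ => Finset.sum_congr rfl fun i _ => by ring
  have hrank : (Finset.univ.filter fun i => g i ≠ 0).card ≤ S₂.card + S₃.card := by
    have h1 := Matrix.rank_diagonal g
    rw [Fintype.card_subtype] at h1
    rw [← h1, hAB]
    refine (Matrix.rank_mul_le_left A B).trans ((Matrix.rank_le_card_width A).trans_eq ?_)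
    rw [Fintype.card_sum, Fintype.card_coe, Fintype.card_coe]
  omega

/-- A diagonal tensor that is a sum of products, each with one of its three factors taken from a
family indexed by `S`, has size at most `3 |S|`. -/
lemma card_le_three_mul_of_sum_mul {F I κ θ : Type*} [Field F] [Fintype I] [DecidableEq I]
    [DecidableEq κ] (T : Finset θ) (S : Finset κ) (g₁ g₂ g₃ : θ → κ) (u₁ u₂ u₃ : κ → I → F)
    (hT : ∀ t ∈ T, g₁ t ∈ S ∨ g₂ t ∈ S ∨ g₃ t ∈ S)
    (h : ∀ i j k, (if i = j ∧ j = k then (1 : F) else 0) =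
      ∑ t ∈ T, u₁ (g₁ t) i * u₂ (g₂ t) j * u₃ (g₃ t) k) :
    Fintype.card I ≤ 3 * S.card := by
  let T₁ := T.filter fun t => g₁ t ∈ S
  let T' := T.filter fun t => ¬ g₁ t ∈ S
  let T₂ := T'.filter fun t => g₂ t ∈ S
  let T₃ := T'.filter fun t => ¬ g₂ t ∈ S
  have hT₃ : ∀ t ∈ T₃, g₃ t ∈ S := by
    intro t ht
    simp only [T₃, T', Finset.mem_filter] at ht
    have := hT t ht.1.1
    tauto
  have hfib : ∀ (R : Finset θ) (e : θ → κ) (_ : ∀ t ∈ R, e t ∈ S) (v : κ → F) (w : θ → F),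
      ∑ a ∈ S, v a * ∑ t ∈ R.filter (fun t => e t = a), w t = ∑ t ∈ R, v (e t) * w t := by
    intro R e he v w
    rw [← Finset.sum_fiberwise_of_maps_to he]
    refine Finset.sum_congr rfl fun a _ => ?_
    rw [Finset.mul_sum]
    exact Finset.sum_congr rfl fun t ht => by rw [(Finset.mem_filter.1 ht).2]
  have := card_le_of_slice_decomposition S S S u₁ u₂ u₃
    (fun a j k => ∑ t ∈ T₁.filter (fun t => g₁ t = a), u₂ (g₂ t) j * u₃ (g₃ t) k)
    (fun a i k => ∑ t ∈ T₂.filter (fun t => g₂ t = a), u₁ (g₁ t) i * u₃ (g₃ t) k)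
    (fun a i j => ∑ t ∈ T₃.filter (fun t => g₃ t = a), u₁ (g₁ t) i * u₂ (g₂ t) j)
    (fun i j k => by
      rw [h i j k, hfib T₁ g₁ (fun t ht => (Finset.mem_filter.1 ht).2) (fun a => u₁ a i),
        hfib T₂ g₂ (fun t ht => (Finset.mem_filter.1 ht).2) (fun a => u₂ a j),
        hfib T₃ g₃ hT₃ (fun a => u₃ a k), add_assoc,
        ← Finset.sum_filter_add_sum_filter_not T (fun t => g₁ t ∈ S),
        ← Finset.sum_filter_add_sum_filter_not T' (fun t => g₂ t ∈ S)]
      refine congrArg₂ _ ?_ (congrArg₂ _ ?_ ?_) <;>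
        exact Finset.sum_congr rfl fun t _ => by ring)
  omega

/-! ### The upper bound -/

/-- The exponent vectors of degree at most one third of the maximum. -/
def lowDegree (ι : Type*) [Fintype ι] [DecidableEq ι] (m : ℕ) : Finset (ι → Fin m) :=
  Finset.univ.filter fun a => 3 * ∑ l, (a l : ℕ) ≤ Fintype.card ι * (m - 1)

/-- The exponential moment bound for the number of vectors of low degree. -/
lemma card_lowDegree_le (ι : Type*) [Fintype ι] [DecidableEq ι] (n : ℕ) {x : ℝ} (hx0 : 0 < x)
    (hx1 : x ≤ 1) :
    ((lowDegree ι (n + 1)).card : ℝ) ≤ Real.exp (Fintype.card ι *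
      (Real.log (∑ j ∈ Finset.range (n + 1), x ^ j) - n / 3 * Real.log x)) := by
  set Z := ∑ j ∈ Finset.range (n + 1), x ^ j with hZdef
  have hZ : 0 < Z := Finset.sum_pos (fun i _ => by positivity) ⟨0, by simp⟩
  have hlog : Real.log x ≤ 0 := Real.log_nonpos hx0.le hx1
  have hsum : ∑ a : ι → Fin (n + 1), ∏ l, x ^ (a l : ℕ) = Z ^ Fintype.card ι := by
    rw [← Fintype.prod_sum (κ := fun _ : ι => Fin (n + 1)) (fun _ j => x ^ (j : ℕ)),
      Finset.prod_const, Finset.card_univ, Fin.sum_univ_eq_sum_range (fun j => x ^ j)]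
  have hlow : ∀ a ∈ lowDegree ι (n + 1), Real.exp (Fintype.card ι * (n / 3 * Real.log x)) ≤
      ∏ l, x ^ (a l : ℕ) := by
    intro a ha
    have h1 : 3 * ∑ l, (a l : ℕ) ≤ Fintype.card ι * n := (Finset.mem_filter.1 ha).2
    have h2 : (3 : ℝ) * (∑ l, (a l : ℕ) : ℕ) ≤ Fintype.card ι * n := by exact_mod_cast h1
    rw [Finset.prod_pow_eq_pow_sum, ← Real.exp_log (pow_pos hx0 (∑ l, (a l : ℕ))), Real.log_pow,
      Real.exp_le_exp]
    nlinarith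
  have hle : ((lowDegree ι (n + 1)).card : ℝ) *
      Real.exp (Fintype.card ι * (n / 3 * Real.log x)) ≤ Z ^ Fintype.card ι := by
    rw [← hsum, ← nsmul_eq_mul]
    refine (Finset.card_nsmul_le_sum _ _ _ hlow).trans ?_
    exact Finset.sum_le_sum_of_subset_of_nonneg (Finset.subset_univ _)
      fun a _ _ => Finset.prod_nonneg fun l _ => by positivity
  rw [mul_sub, Real.exp_sub, le_div_iff₀ (Real.exp_pos _)]
  refine hle.trans_eq ?_
  rw [← Real.log_pow, Real.exp_log (by positivity)]

/-- Slice rank bound: the indicator tensor of `x + y + z = 0` on `(ZMod (p ^ k)) ^ ι` is a sum of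
products of binomial functions, in each of which some factor has low degree. -/
theorem maxTricolored_le_three_mul_card_lowDegree (p k : ℕ) [Fact p.Prime] (ι : Type*) [Fintype ι]
    [DecidableEq ι] :
    maxTricolored (ι → ZMod (p ^ k)) ≤ 3 * (lowDegree ι (p ^ k)).card := by
  classical
  obtain ⟨Γ, hΓ, hcard⟩ := exists_ncard_eq_maxTricolored (ι → ZMod (p ^ k))
  rw [← hcard, ← Nat.card_coe_set_eq]
  have : Fintype Γ := Fintype.ofFinite Γ
  rw [Nat.card_eq_fintype_card]
  let T₀ : Finset (Fin (p ^ k) × Fin (p ^ k) × Fin (p ^ k)) :=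
    Finset.univ.filter fun t => (t.1 : ℕ) + t.2.1 + t.2.2 = p ^ k - 1
  let T : Finset (ι → Fin (p ^ k) × Fin (p ^ k) × Fin (p ^ k)) := Fintype.piFinset fun _ => T₀
  refine card_le_three_mul_of_sum_mul (F := ZMod p) T (lowDegree ι (p ^ k))
    (fun t l => (t l).1) (fun t l => (t l).2.1) (fun t l => (t l).2.2)
    (fun a i => ∏ l, binomFun p k (a l) (i.1.1 l)) (fun a i => ∏ l, binomFun p k (a l) (i.1.2.1 l))
    (fun a i => ∏ l, shiftedBinomFun p k (a l) (i.1.2.2 l)) ?_ ?_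
  · intro t ht
    have h1 : ∀ l, ((t l).1 : ℕ) + (t l).2.1 + (t l).2.2 = p ^ k - 1 := fun l => by
      simpa [T₀] using Fintype.mem_piFinset.1 ht l
    have h2 : ∑ l, ((t l).1 : ℕ) + ∑ l, ((t l).2.1 : ℕ) + ∑ l, ((t l).2.2 : ℕ) =
        Fintype.card ι * (p ^ k - 1) := by
      rw [← Finset.sum_add_distrib, ← Finset.sum_add_distrib, Finset.sum_congr rfl fun l _ => h1 l,
        Finset.sum_const, Finset.card_univ, smul_eq_mul]
    simp only [lowDegree, Finset.mem_filter, Finset.mem_univ, true_and]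
    omega
  · intro i j l
    simp only [← Finset.prod_mul_distrib]
    have h1 : ∏ e, (∑ t ∈ T₀, binomFun p k t.1 (i.1.1 e) * binomFun p k t.2.1 (j.1.2.1 e) *
        shiftedBinomFun p k t.2.2 (l.1.2.2 e)) = if i = j ∧ j = l then 1 else 0 := by
      simp only [T₀, sum_binomFun_eq_ite]
      have h2 := hΓ.2 _ ⟨i.1, i.2, rfl⟩ _ ⟨j.1, j.2, rfl⟩ _ ⟨l.1, l.2, rfl⟩
      have h3 : i.1.1 + j.1.2.1 + l.1.2.2 = 0 ↔ i = j ∧ j = l := by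
        rw [h2]
        constructor
        · intro h4
          have e1 : (i.1.1, j.1.2.1, l.1.2.2) = i.1 := by
            by_contra hne
            exact (hΓ.1 _ h4 _ i.2 hne).1 rfl
          have e2 : (i.1.1, j.1.2.1, l.1.2.2) = j.1 := by
            by_contra hne
            exact (hΓ.1 _ h4 _ j.2 hne).2.1 rfl
          have e3 : (i.1.1, j.1.2.1, l.1.2.2) = l.1 := by
            by_contra hne
            exact (hΓ.1 _ h4 _ l.2 hne).2.2 rfl
          exact ⟨Subtype.ext (e1.symm.trans e2), Subtype.ext (e2.symm.trans e3)⟩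
        · rintro ⟨rfl, rfl⟩
          exact i.2
      by_cases h0 : i.1.1 + j.1.2.1 + l.1.2.2 = 0
      · rw [if_pos (h3.1 h0)]
        exact Finset.prod_eq_one fun e _ => if_pos (congrFun h0 e)
      · rw [if_neg fun h => h0 (h3.2 h)]
        obtain ⟨e, he⟩ := Function.ne_iff.1 h0
        exact Finset.prod_eq_zero (Finset.mem_univ e) (if_neg he)
    rw [← h1, Finset.prod_univ_sum]

/-! ### Strassen's equation -/

/-- `strassenPoly n x = 0` says that the distribution proportional to `x ^ i` on `{0, …, n}` has
mean `n / 3`. It is Strassen's equation for `m = n + 1` in the variable `x = γ⁻¹`. -/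
noncomputable def strassenPoly (n : ℕ) (x : ℝ) : ℝ :=
  ∑ i ∈ Finset.range (n + 1), (3 * (i : ℝ) - n) * x ^ i

lemma sub_one_mul_sum_mul_pow (n : ℕ) (g : ℝ) :
    (g - 1) * ∑ i ∈ Finset.range (n + 1), (i : ℝ) * g ^ i =
      n * g ^ (n + 1) - ∑ i ∈ Finset.range (n + 1), g ^ i + 1 := by
  induction n with
  | zero => simp
  | succ n ih =>
    rw [Finset.sum_range_succ, mul_add, ih, Finset.sum_range_succ (fun i => g ^ i) (n + 1)]
    push_cast
    ring

lemma sub_one_mul_strassenPoly (n : ℕ) (g : ℝ) :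
    (g - 1) * strassenPoly n g =
      2 * n * g ^ (n + 1) + 3 + n - 3 * ∑ i ∈ Finset.range (n + 1), g ^ i := by
  have h1 := sub_one_mul_sum_mul_pow n g
  have h2 := mul_geom_sum g (n + 1)
  have h3 : strassenPoly n g = 3 * ∑ i ∈ Finset.range (n + 1), (i : ℝ) * g ^ i
      - n * ∑ i ∈ Finset.range (n + 1), g ^ i := by
    simp only [strassenPoly, sub_mul, Finset.sum_sub_distrib, mul_assoc, Finset.mul_sum]
  rw [h3]
  linear_combination 3 * h1 - n * h2

lemma isStrassenRoot_iff {n : ℕ} {g : ℝ} :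
    IsStrassenRoot (n + 1) g ↔ 0 < g ∧ g ≠ 1 ∧ strassenPoly n g⁻¹ = 0 := by
  unfold IsStrassenRoot
  refine and_congr_right fun h0 => and_congr_right fun h1 => ?_
  obtain ⟨x, rfl⟩ : ∃ x, g = x⁻¹ := ⟨g⁻¹, (inv_inv g).symm⟩
  have hx0 : 0 < x := inv_pos.1 h0
  have hx1 : x ≠ 1 := fun h => h1 (by rw [h, inv_one])
  rw [inv_inv]
  have hx1' : x - 1 ≠ 0 := sub_ne_zero.2 hx1
  have hxm : x ^ (n + 1) - 1 ≠ 0 := by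
    rw [sub_ne_zero]
    exact fun h => hx1 ((pow_eq_one_iff_of_nonneg hx0.le (Nat.succ_ne_zero n)).1 h)
  have hx1'' : 1 - x ≠ 0 := fun h => hx1' (by linarith)
  have hxm' : 1 - x ^ (n + 1) ≠ 0 := fun h => hxm (by linarith)
  have hgeom := geom_sum_eq hx1 (n + 1)
  have hpoly := sub_one_mul_strassenPoly n x
  rw [hgeom] at hpoly
  have e1 : 1 / (x⁻¹ - 1) = x / (1 - x) := by field_simp
  have e2 : ((n + 1 : ℕ) : ℝ) / (x⁻¹ ^ (n + 1) - 1) =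
      (n + 1) * x ^ (n + 1) / (1 - x ^ (n + 1)) := by
    push_cast
    rw [inv_pow]
    field_simp
  have key : x / (1 - x) - (n + 1) * x ^ (n + 1) / (1 - x ^ (n + 1)) - n / 3 =
      (x - 1) * strassenPoly n x / (3 * (x ^ (n + 1) - 1)) := by
    rw [hpoly]
    have e3 : x / (1 - x) = -(x / (x - 1)) := by rw [← div_neg, neg_sub]
    have e4 : (n + 1) * x ^ (n + 1) / (1 - x ^ (n + 1)) =
        -((n + 1) * x ^ (n + 1) / (x ^ (n + 1) - 1)) := by rw [← div_neg, neg_sub]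
    rw [e3, e4]
    field_simp
    ring
  rw [e1, e2]
  push_cast
  rw [add_sub_cancel_right, ← sub_eq_zero, key, div_eq_zero_iff, mul_eq_zero]
  simp [hx1', hxm]

lemma strassenPoly_pos_of_root {n : ℕ} (hn : 0 < n) {x y : ℝ} (hx : 0 < x) (hxy : x < y)
    (h : strassenPoly n x = 0) : 0 < strassenPoly n y := by
  -- Passing from `x` to `y` multiplies the positive terms by larger factors than the others.
  set r := y / x with hr
  have hr1 : 1 < r := (one_lt_div hx).2 hxy
  have hy : ∀ i : ℕ, y ^ i = r ^ i * x ^ i := fun i => by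
    rw [hr, ← mul_pow, div_mul_cancel₀ _ hx.ne']
  have h2 : r ^ (n / 3) * strassenPoly n x < strassenPoly n y := by
    rw [strassenPoly, strassenPoly, Finset.mul_sum]
    refine Finset.sum_lt_sum ?_ ⟨n, by simp, ?_⟩
    · intro i _
      rw [hy, ← sub_nonneg]
      have e : (3 * (i : ℝ) - n) * (r ^ i * x ^ i) - r ^ (n / 3) * ((3 * (i : ℝ) - n) * x ^ i) =
          (3 * (i : ℝ) - n) * (r ^ i - r ^ (n / 3)) * x ^ i := by ring
      rw [e]
      refine mul_nonneg ?_ (by positivity)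
      rcases le_or_gt i (n / 3) with hi | hi
      · refine mul_nonneg_of_nonpos_of_nonpos ?_ (sub_nonpos.2 (pow_le_pow_right₀ hr1.le hi))
        have : 3 * i ≤ n := by omega
        have : 3 * (i : ℝ) ≤ n := by exact_mod_cast this
        linarith
      · refine mul_nonneg ?_ (sub_nonneg.2 (pow_le_pow_right₀ hr1.le hi.le))
        have : n ≤ 3 * i := by omega
        have : (n : ℝ) ≤ 3 * i := by exact_mod_cast this
        linarith
    · rw [hy, ← sub_pos]
      have e : (3 * (n : ℝ) - n) * (r ^ n * x ^ n) - r ^ (n / 3) * ((3 * (n : ℝ) - n) * x ^ n) =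
          (2 * (n : ℝ)) * (r ^ n - r ^ (n / 3)) * x ^ n := by ring
      rw [e]
      have hn' : (0 : ℝ) < n := by exact_mod_cast hn
      have := sub_pos.2 (pow_lt_pow_right₀ hr1 (by omega : n / 3 < n))
      positivity
  rwa [h, mul_zero] at h2

lemma exists_strassenPoly_root {n : ℕ} (hn : 0 < n) :
    ∃ x : ℝ, 0 < x ∧ x < 1 ∧ strassenPoly n x = 0 := by
  have hn' : (0 : ℝ) < n := by exact_mod_cast hn
  have h0 : strassenPoly n 0 = -n := by
    rw [strassenPoly, Finset.sum_range_succ']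
    simp
  have h1 : strassenPoly n 1 = n * (n + 1) / 2 := by
    rw [← sum_range_weight, strassenPoly]
    simp only [one_pow, mul_one]
  have hcont : ContinuousOn (strassenPoly n) (Set.Icc 0 1) := by
    unfold strassenPoly
    fun_prop
  have hpos : 0 < strassenPoly n 1 := by rw [h1]; positivity
  obtain ⟨x, hx, hroot⟩ := intermediate_value_Icc zero_le_one hcont
    (show (0 : ℝ) ∈ Set.Icc _ _ from ⟨by rw [h0]; linarith, hpos.le⟩)
  refine ⟨x, lt_of_le_of_ne hx.1 ?_, lt_of_le_of_ne hx.2 ?_, hroot⟩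
  · rintro rfl; rw [h0] at hroot; linarith
  · rintro rfl; linarith

lemma eq_of_strassenPoly_eq_zero {n : ℕ} (hn : 0 < n) {x y : ℝ} (hx : 0 < x) (hy : 0 < y)
    (h : strassenPoly n x = 0) (h' : strassenPoly n y = 0) : x = y := by
  rcases lt_trichotomy x y with hlt | rfl | hlt
  · exact absurd h' (strassenPoly_pos_of_root hn hx hlt h).ne'
  · rfl
  · exact absurd h (strassenPoly_pos_of_root hn hy hlt h').ne'

lemma strassenExpr_inv {n : ℕ} {x : ℝ} (hx0 : 0 < x) (hx1 : x ≠ 1) :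
    strassenExpr (n + 1) x⁻¹ =
      Real.exp (Real.log (∑ j ∈ Finset.range (n + 1), x ^ j) - n / 3 * Real.log x) := by
  have hZ : 0 < ∑ j ∈ Finset.range (n + 1), x ^ j :=
    Finset.sum_pos (fun i _ => by positivity) ⟨0, by simp⟩
  have h1 : ((x⁻¹) ^ (n + 1) - 1) / (x⁻¹ - 1) =
      x⁻¹ ^ n * ∑ j ∈ Finset.range (n + 1), x ^ j := by
    rw [← geom_sum_eq (fun h => hx1 (inv_eq_one.1 h)), Finset.mul_sum, ← Finset.sum_range_reflect]
    refine Finset.sum_congr rfl fun j hj => ?_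
    have hj' : j ≤ n := Nat.lt_succ_iff.1 (Finset.mem_range.1 hj)
    obtain ⟨d, rfl⟩ := Nat.exists_eq_add_of_le hj'
    have e : j + d + 1 - 1 - j = d := by omega
    rw [e, pow_add, mul_comm (x⁻¹ ^ j), mul_assoc, ← mul_pow, inv_mul_cancel₀ hx0.ne', one_pow,
      mul_one]
  rw [strassenExpr, h1, Real.rpow_def_of_pos (inv_pos.2 hx0), Real.log_inv, Real.exp_sub,
    Real.exp_log hZ, ← Real.exp_log (pow_pos (inv_pos.2 hx0) n), Real.log_pow, Real.log_inv,
    eq_div_iff (Real.exp_pos _).ne']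
  have hE : Real.exp (n * -Real.log x) * Real.exp (-Real.log x * -(2 * ((n + 1 : ℕ) - 1 : ℝ) / 3)) *
      Real.exp (n / 3 * Real.log x) = 1 := by
    rw [← Real.exp_add, ← Real.exp_add, Real.exp_eq_one_iff]
    push_cast
    ring
  linear_combination (∑ j ∈ Finset.range (n + 1), x ^ j) * hE

/-! ### The growth rate -/

theorem hasRegularisedMaxTricolored_of_strassenPoly {p k n m : ℕ} [Fact p.Prime] [NeZero m]
    (hm : m = p ^ k) (hmn : m = n + 1) (hn : 0 < n) {x : ℝ} (hx0 : 0 < x) (hx1 : x ≤ 1)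
    (hx : strassenPoly n x = 0) :
    HasRegularisedMaxTricolored (ZMod m)
      (Real.exp (Real.log (∑ j ∈ Finset.range (n + 1), x ^ j) - n / 3 * Real.log x)) := by
  set r := Real.log (∑ j ∈ Finset.range (n + 1), x ^ j) - n / 3 * Real.log x with hr
  have hupper : ∀ L : ℕ, (maxTricolored (Fin L → ZMod m) : ℝ) ≤ 3 * Real.exp (L * r) := by
    intro L
    have h1 : maxTricolored (Fin L → ZMod m) ≤ 3 * (lowDegree (Fin L) m).card := by
      subst hm
      exact maxTricolored_le_three_mul_card_lowDegree p k (Fin L)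
    have h2 : ((lowDegree (Fin L) m).card : ℝ) ≤ Real.exp (L * r) := by
      subst hmn
      simpa using card_lowDegree_le (Fin L) n hx0 hx1
    calc (maxTricolored (Fin L → ZMod m) : ℝ) ≤ 3 * (lowDegree (Fin L) m).card := by
          exact_mod_cast h1
      _ ≤ _ := by gcongr
  obtain ⟨a, ha, hlower⟩ : ∃ a : ℕ → ℝ, Tendsto a atTop (𝓝 r) ∧
      ∀ L : ℕ, 0 < L → Real.exp (L * a L) ≤ maxTricolored (Fin L → ZMod m) := by
    subst hmn
    exact exists_lower_rate hn hx0 hx1 hx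
  have hlim3 : Tendsto (fun L : ℕ => (3 : ℝ) ^ ((1 : ℝ) / L) * Real.exp r) atTop
      (𝓝 (Real.exp r)) := by
    have h1 : Tendsto (fun L : ℕ => (3 : ℝ) ^ ((1 : ℝ) / L)) atTop (𝓝 ((3 : ℝ) ^ (0 : ℝ))) :=
      (Real.continuous_const_rpow (by norm_num)).continuousAt.tendsto.comp
        tendsto_one_div_atTop_nhds_zero_nat
    simpa using h1.mul_const (Real.exp r)
  have hroot : ∀ L : ℕ, 0 < L → ∀ c : ℝ, Real.exp (L * c) ^ ((1 : ℝ) / L) = Real.exp c := by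
    intro L hL c
    have hL' : (L : ℝ) ≠ 0 := by exact_mod_cast hL.ne'
    rw [← Real.exp_mul]
    congr 1
    field_simp
  refine tendsto_of_tendsto_of_tendsto_of_le_of_le' ((Real.continuous_exp.tendsto r).comp ha)
    hlim3 ?_ ?_
  · filter_upwards [eventually_gt_atTop 0] with L hL
    rw [Function.comp_apply, ← hroot L hL (a L)]
    exact Real.rpow_le_rpow (Real.exp_pos _).le (hlower L hL) (by positivity)
  · filter_upwards [eventually_gt_atTop 0] with L hL
    rw [← hroot L hL r, ← Real.mul_rpow (by norm_num) (Real.exp_pos _).le]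
    exact Real.rpow_le_rpow (Nat.cast_nonneg _) (hupper L) (by positivity)

theorem exists_strassenRoot_hasRegularisedMaxTricolored {p k m : ℕ} [Fact p.Prime] [NeZero m]
    (hm : m = p ^ k) (hk : 0 < k) :
    ∃ γ : ℝ, IsStrassenRoot m γ ∧ (∀ γ' : ℝ, IsStrassenRoot m γ' → γ' = γ) ∧
      HasRegularisedMaxTricolored (ZMod m) (strassenExpr m γ) := by
  have hm1 : 1 < m := by
    rw [hm]; exact Nat.one_lt_pow hk.ne' (Fact.out : p.Prime).one_lt
  obtain ⟨n, hn⟩ : ∃ n, m = n + 1 := ⟨m - 1, by omega⟩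
  have hn0 : 0 < n := by omega
  obtain ⟨x, hx0, hx1, hx⟩ := exists_strassenPoly_root hn0
  refine ⟨x⁻¹, ?_, ?_, ?_⟩
  · rw [hn, isStrassenRoot_iff, inv_inv]
    exact ⟨inv_pos.2 hx0, fun h => hx1.ne (inv_eq_one.1 h), hx⟩
  · intro γ' h
    rw [hn, isStrassenRoot_iff] at h
    rw [← inv_inv γ', eq_of_strassenPoly_eq_zero hn0 (inv_pos.2 h.1) hx0 h.2.2 hx]
  · have := hasRegularisedMaxTricolored_of_strassenPoly hm hn hn0 hx0 hx1.le hx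
    rwa [← strassenExpr_inv hx0 hx1.ne, ← hn] at this

lemma strassenExpr_three {γ : ℝ} (hγ : IsStrassenRoot 3 γ) :
    strassenExpr 3 γ = 3 * (207 + 33 * Real.sqrt 33) ^ ((1 : ℝ) / 3) / 8 := by
  have h := isStrassenRoot_iff.1 (show IsStrassenRoot (2 + 1) γ from hγ)
  obtain ⟨h0, h1, hp⟩ := h
  have hquad : 2 * γ ^ 2 - γ - 4 = 0 := by
    simp only [strassenPoly, Finset.sum_range_succ, Finset.sum_range_zero] at hp
    push_cast at hp
    field_simp at hp
    linarith
  have hs : Real.sqrt 33 = 4 * γ - 1 := by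
    rw [Real.sqrt_eq_iff_mul_self_eq (by norm_num)]
    · linear_combination (-8) * hquad
    · nlinarith
  have hg : γ - 1 ≠ 0 := sub_ne_zero.2 h1
  have e1 : (γ ^ 3 - 1) / (γ - 1) = 3 * (γ + 2) / 2 := by
    rw [div_eq_iff hg]
    linear_combination (1 / 2) * (γ - 1) * hquad
  have e2 : (207 + 33 * Real.sqrt 33 : ℝ) = (4 * (γ + 2)) ^ 3 * (γ ^ 4)⁻¹ := by
    rw [hs, eq_mul_inv_iff_mul_eq₀ (by positivity)]
    linear_combination (66 * γ ^ 3 + 120 * γ ^ 2 + 160 * γ + 128) * hquad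
  rw [strassenExpr, e1, e2, Real.mul_rpow (by positivity) (by positivity),
    ← Real.rpow_natCast (4 * (γ + 2)) 3, ← Real.rpow_mul (by positivity), ← Real.rpow_natCast γ 4,
    ← Real.rpow_neg h0.le, ← Real.rpow_mul h0.le]
  norm_num
  ring

lemma isCombinatorialDegeneration_sumSupport (m : ℕ) :
    IsCombinatorialDegeneration (modSumSupport m) (sumSupport m) := by
  refine ⟨fun α hα => ?_, fun a => a, fun b => b, fun c => (c : ℤ) - (m - 1), fun α => ⟨?_, ?_⟩⟩
  · have h : (α.1 : ℕ) + (α.2.1 : ℕ) + (α.2.2 : ℕ) = m - 1 := hα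
    show (α.1 : ℕ) + (α.2.1 : ℕ) + (α.2.2 : ℕ) ≡ m - 1 [MOD m]
    rw [h]
  · rintro ⟨h, h'⟩
    have hm := α.1.2
    have h1 : (α.1 : ℕ) + (α.2.1 : ℕ) + (α.2.2 : ℕ) ≡ m - 1 [MOD m] := h
    have h2 : (α.1 : ℕ) + (α.2.1 : ℕ) + (α.2.2 : ℕ) ≠ m - 1 := h'
    rw [Nat.ModEq, Nat.mod_eq_of_lt (by omega : m - 1 < m)] at h1
    have h3 := Nat.mod_le ((α.1 : ℕ) + (α.2.1 : ℕ) + (α.2.2 : ℕ)) m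
    simp only
    omega
  · intro h
    have hm := α.1.2
    have h1 : (α.1 : ℕ) + (α.2.1 : ℕ) + (α.2.2 : ℕ) = m - 1 := h
    simp only
    omega

theorem mainTheorem11 :
    HasRegularisedMaxTricolored (ZMod 3)
      (3 * (207 + 33 * Real.sqrt 33) ^ ((1 : ℝ) / 3) / 8) ∧
    ∀ (p k : ℕ) [Fact p.Prime], 0 < k →
      (∃ γ : ℝ, IsStrassenRoot (p ^ k) γ ∧ (∀ γ' : ℝ, IsStrassenRoot (p ^ k) γ' → γ' = γ) ∧
        HasRegularisedMaxTricolored (ZMod (p ^ k)) (strassenExpr (p ^ k) γ)) ∧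
      (∀ b : Module.Basis (Fin (p ^ k)) (ZMod p)
          (AdjoinRoot (Polynomial.X ^ (p ^ k) : (ZMod p)[X])),
        TensorIsomorphic (capSetTensor (ZMod p) (p ^ k)) (structureTensor b)) ∧
      IsCombinatorialDegeneration (modSumSupport (p ^ k)) (sumSupport (p ^ k)) := by
  constructor
  · obtain ⟨γ, hγ, -, h⟩ := exists_strassenRoot_hasRegularisedMaxTricolored (p := 3) (k := 1)
      (m := 3) (pow_one 3).symm one_pos
    rwa [strassenExpr_three hγ] at h
  · intro p k _ hk
    exact ⟨exists_strassenRoot_hasRegularisedMaxTricolored rfl hk,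
      tensorIsomorphic_capSetTensor p k, isCombinatorialDegeneration_sumSupport (p ^ k)⟩
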